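/- **Setting.** Let $d\ge 2$ and let $f:[0,1]^d\to\mathbb R$ be differentiable with $1$-Lipschitz gradient, $\|\nabla f(x)-\nabla f(y)\|_2\le\|x-y\|_2$ on $[0,1]^d$. A point $x\in[0,1]^d$ is an $\varepsilon$-stationary point of $f$ if for every $\varepsilon'>\varepsilon$ there is a neighbourhood $N$ of $x$ in $[0,1]^d$ such that $f(x)\le f(y)+\varepsilon'\|x-y\|_2$ for all $y\in N$. In the parallel query model an algorithm submits, in rounds, finite sets of points of $[0,1]^d$ and receives the values of $f$ at them; its depth is the number of rounds and its total work is the total number of queried points. **The algorithm ($d$-dimensional gradient flow trapping, GFT) with target accuracy $\varepsilon$.** Put $\eta=\varepsilon/4$ and $L=500\log(d/\varepsilon)$. To query a $\delta$-net on a $(d-1)$-dimensional axis-aligned hyperrectangle $E$ means to query the product grid, endpoints included, that divides each of the $d-1$ sides $\ell$ of $E$ into $\lceil \sqrt{d-1}\,\ell/\delta\rceil$ equal parts. GFT maintains an axis-aligned hyperrectangle $R=\prod_i[a_i,b_i]\subset[0,1]^d$, a pivot $x\in R$, a number $\varepsilon_t$, and a set of "fixed" faces of $R$. It starts (after querying the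 pivot) with $R=[0,1]^d$, $x=(\frac12,\dots,\frac12)$, $\varepsilon_0=\eta$; at the start and whenever $R$ is replaced by a smaller hyperrectangle, the fixed faces are reset to the faces of $R$ contained in $\partial[0,1]^d$. While $\operatorname{diam}(R)>2\eta$ it performs one of two steps. 1. *Parallel trap*, if all $2d$ faces of $R$ are fixed. Let $k$ be a direction in which $R$ is longest and $r$ the largest side length of $R$ in the other directions. Up to reflecting the $k$-th coordinate, assume $x_k\ge(a_k+b_k)/2$. Query $\sqrt{r\eta}$-nets on $E=R\cap\{y_k=a_k+r/6\}$ and $F=R\cap\{y_k=a_k+r/3\}$, and let $\bar x$ be the best queried point. If $f(x)\le f(\bar x)$, keep $x$ and replace $R$ by $R\cap\{y_k\ge a_k+r/3\}$. Otherwise the pivot becomes $\bar x$, and $R$ is replaced by $R\cap\{y_k\ge a_k+r/6\}$ if $\bar x\in F$, and by $R\cap\{y_k\le a_k+r/3\}$ if $\bar x\in E$. Set $\varepsilon_{t+1}=\eta$. 2. *Edge fixing*, otherwise. Let $\mathcal E$ be a face closest to $x$ among those that are not fixed, let $r$ be its distance to $x$, and let $x_0=x$. For $i=1,2,3$ in turn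 let $R_i=R\cap\{y:\|y-x_{i-1}\|_\infty\le r/3\}$, query $\sqrt{\varepsilon_t r/L}$-nets on the $2d$ faces of $R_i$, and let $x_i$ be the best point found on them. If $f(x_i)\le f(x_{i-1})-\varepsilon_t r/3$ for $i=1,2,3$, then $R$ is kept, the pivot becomes $x_3$, $\mathcal E$ is added to the fixed faces and $\varepsilon_{t+1}=\varepsilon_t$. Otherwise, for the smallest $i$ violating this, $(R,x)$ is replaced by $(R_i,x_{i-1})$ and $\varepsilon_{t+1}=(1+\frac1L)\varepsilon_t$. When the loop stops, the output is the pivot moved onto those faces of $R$ that lie in $\partial[0,1]^d$: its $i$-th coordinate is replaced by $0$ if $a_i=0$ and by $1$ if $b_i=1$. Ties are broken arbitrarily but deterministically. **Theorem 2.** There is a universal constant $C>0$ such that for all $d\ge2$, all $0<\varepsilon\le\frac12$ and all $f$ as above, GFT stops, makes all its queries in $[0,1]^d$, and outputs an $\varepsilon$-stationary point of $f$, in depth at most $C\,d^2\log(d/\varepsilon)$ and with total work at most $$d^{\,Cd}\left(\frac{\log(1/\varepsilon)}{\varepsilon}\right)^{\frac{d-1}{2}} .$$ -/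

import Mathlib

open scoped Topology

noncomputable section

namespace GFT

/-! ### The parallel query model (zeroth-order oracle) -/

/-- A program that interacts with a value oracle on `X` in rounds. A round submits a finite batch of
points, and the rest of the program may depend only on the values returned for that batch. -/
inductive QueryProg (X : Type) (α : Type) : Type
  | pure (a : α) : QueryProg X α
  | query (batch : Finset X) (next : ({p : X // p ∈ batch} → ℝ) → QueryProg X α) : QueryProg X α

namespace QueryProg

variable {X α : Type}

/-- The value returned when the oracle answers with the values of `f`. -/
def result (f : X → ℝ) : QueryProg X α → α
  | pure a => a
  | query _ next => (next fun p => f p.1).result f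

/-- The number of rounds of interaction with the oracle. -/
def depth (f : X → ℝ) : QueryProg X α → ℕ
  | pure _ => 0
  | query _ next => 1 + (next fun p => f p.1).depth f

/-- The total number of queried points. -/
def work (f : X → ℝ) : QueryProg X α → ℕ
  | pure _ => 0
  | query batch next => batch.card + (next fun p => f p.1).work f

/-- Every point queried during the run against `f` lies in `K`. -/
def QueriesIn (K : Set X) (f : X → ℝ) : QueryProg X α → Prop
  | pure _ => True
  | query batch next => (∀ p ∈ batch, p ∈ K) ∧ (next fun p => f p.1).QueriesIn K f

end QueryProg

/-- A (deterministic) algorithm in the parallel query model: an initialisation, followed by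
`while not halted do step`, followed by an output that makes no further query. -/
structure ParallelAlgorithm (X : Type) where
  State : Type
  init : QueryProg X State
  halted : State → Prop
  step : State → QueryProg X State
  output : State → X

namespace ParallelAlgorithm

variable {X : Type} (A : ParallelAlgorithm X) (f : X → ℝ)

/-- The state after `t` passes through the loop, when the oracle answers with the values of `f`. -/
def stateAt : ℕ → A.State
  | 0 => A.init.result f
  | t + 1 => (A.step (stateAt t)).result f

/-- The loop stops after exactly `T` passes. -/
def StopsAt (T : ℕ) : Prop :=
  A.halted (A.stateAt f T) ∧ ∀ t < T, ¬ A.halted (A.stateAt f t)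

/-- The depth (number of rounds) of a run with `T` passes through the loop. -/
def depth (T : ℕ) : ℕ :=
  A.init.depth f + ∑ t ∈ Finset.range T, (A.step (A.stateAt f t)).depth f

/-- The total work (number of queries) of a run with `T` passes through the loop. -/
def work (T : ℕ) : ℕ :=
  A.init.work f + ∑ t ∈ Finset.range T, (A.step (A.stateAt f t)).work f

/-- All queries of a run with `T` passes through the loop are made at points of `K`. -/
def QueriesIn (K : Set X) (T : ℕ) : Prop :=
  A.init.QueriesIn K f ∧ ∀ t < T, (A.step (A.stateAt f t)).QueriesIn K f

end ParallelAlgorithm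

/-! ### The optimization problem -/

/-- The cube `[0,1]^d`. -/
def cube (d : ℕ) : Set (EuclideanSpace ℝ (Fin d)) :=
  {x | ∀ i, 0 ≤ x i ∧ x i ≤ 1}

/-- `f` is differentiable on `[0,1]^d` and its gradient is `1`-Lipschitz there. (The values of `f`
outside the cube are irrelevant.) -/
def IsSmooth {d : ℕ} (f : EuclideanSpace ℝ (Fin d) → ℝ) : Prop :=
  ∃ g : EuclideanSpace ℝ (Fin d) → EuclideanSpace ℝ (Fin d),
    (∀ x ∈ cube d, HasGradientWithinAt f (g x) (cube d) x) ∧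
    ∀ x ∈ cube d, ∀ y ∈ cube d, ‖g x - g y‖ ≤ ‖x - y‖

/-- `x` is an `ε`-stationary point of `f` on `[0,1]^d`: for every `ε' > ε` there is a neighbourhood
of `x` in the cube on which `f x ≤ f y + ε' ‖x - y‖`. -/
def IsStationary {d : ℕ} (f : EuclideanSpace ℝ (Fin d) → ℝ) (ε : ℝ)
    (x : EuclideanSpace ℝ (Fin d)) : Prop :=
  x ∈ cube d ∧ ∀ ε' > ε, ∀ᶠ y in 𝓝[cube d] x, f x ≤ f y + ε' * ‖x - y‖

/-! ### Hyperrectangles, their faces, and nets -/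

/-- The axis-aligned hyperrectangle `∏ [lower i, upper i]`. -/
structure Hyperrectangle (d : ℕ) where
  lower : Fin d → ℝ
  upper : Fin d → ℝ

namespace Hyperrectangle

variable {d : ℕ} (R : Hyperrectangle d)

/-- The length of `R` in direction `i`. -/
def side (i : Fin d) : ℝ := R.upper i - R.lower i

/-- The Euclidean diameter of `R`. -/
def diam : ℝ := √(∑ i, R.side i ^ 2)

/-- The part of `R` on which the `k`-th coordinate is at least `c`. -/
def above (k : Fin d) (c : ℝ) : Hyperrectangle d := ⟨Function.update R.lower k c, R.upper⟩

/-- The part of `R` on which the `k`-th coordinate is at most `c`. -/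
def below (k : Fin d) (c : ℝ) : Hyperrectangle d := ⟨R.lower, Function.update R.upper k c⟩

/-- `R ∩ {y | ‖x - y‖_∞ ≤ ρ}`. -/
def interBall (x : EuclideanSpace ℝ (Fin d)) (ρ : ℝ) : Hyperrectangle d :=
  ⟨fun i => max (R.lower i) (x i - ρ), fun i => min (R.upper i) (x i + ρ)⟩

/-- The face `(k, false)` is `R ∩ {y | y k = lower k}` and the face `(k, true)` is
`R ∩ {y | y k = upper k}`; this is the value of the `k`-th coordinate on the face. -/
def faceCoord (F : Fin d × Bool) : ℝ := if F.2 then R.upper F.1 else R.lower F.1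

/-- The distance of a point `x` of `R` to a face of `R`. -/
def distFace (x : EuclideanSpace ℝ (Fin d)) (F : Fin d × Bool) : ℝ := |x F.1 - R.faceCoord F|

open scoped Classical in
/-- The faces of `R ⊆ [0,1]^d` that are contained in the boundary of `[0,1]^d`. -/
def outerFaces : Finset (Fin d × Bool) :=
  Finset.univ.filter fun F => R.faceCoord F = if F.2 then 1 else 0

open scoped Classical in
/-- The points that divide `[a,b]` into `m` equal pieces, both endpoints included. -/
def gridPoints (a b : ℝ) (m : ℕ) : Finset ℝ :=
  (Finset.range (m + 1)).image fun i : ℕ => a + (b - a) * i / m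

open scoped Classical in
/-- The grid net on the `(d-1)`-dimensional hyperrectangle `E = R ∩ {y | y k = c}` with spacing at
most `δ / √(d-1)` in each direction. It contains the vertices of `E`, and every point of every face
(of any dimension) of `E` is within `δ / 2` of a point of the net on the same face; in particular it
is a `δ`-net of `E`. -/
def sliceNet (k : Fin d) (c δ : ℝ) : Finset (EuclideanSpace ℝ (Fin d)) :=
  (Fintype.piFinset fun j =>
    if j = k then {c}
    else gridPoints (R.lower j) (R.upper j) ⌈√((d : ℝ) - 1) * R.side j / δ⌉₊).image (WithLp.toLp 2)

open scoped Classical in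
/-- The union of the grid nets on the `2d` faces of `R`. -/
def boundaryNet (δ : ℝ) : Finset (EuclideanSpace ℝ (Fin d)) :=
  Finset.univ.biUnion fun F : Fin d × Bool => R.sliceNet F.1 (R.faceCoord F) δ

/-- A direction in which `R` is longest. -/
def longest [NeZero d] : Fin d := (Finite.exists_max R.side).choose

/-- The largest length of `R` in a direction other than `k`. -/
def otherSide (k : Fin d) : ℝ := ⨆ j : {j : Fin d // j ≠ k}, R.side j

end Hyperrectangle

/-! ### Gradient flow trapping -/

/-- The state of the algorithm: the domain `(R, x)`, the value `f x` of the pivot, the current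
accuracy `ε_t`, and the faces of `R` for which `P_0` has been established: those in the boundary of
`[0,1]^d` and those repaired by edge fixing since the domain last changed. (Here `P_c` for a face `E`
means that `E` is in the boundary of the cube, or that for some `δ > 0` every `δ`-net `N` of `E` has
`f x < inf_N f - δ ^ 2 / 8 + c * dist(x, E)`, uniformly in `N`; it is not evaluated by the algorithm.) -/
structure State (d : ℕ) where
  R : Hyperrectangle d
  pivot : EuclideanSpace ℝ (Fin d)
  value : ℝ
  err : ℝ
  fixed : Finset (Fin d × Bool)

variable {d : ℕ}

open scoped Classical in
/-- A point of the batch of smallest returned value, together with that value. (The batches below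
are non-empty, so that the default `q` is never used.) -/
def best {X : Type} (batch : Finset X) (v : {p : X // p ∈ batch} → ℝ) (q : X × ℝ) : X × ℝ :=
  if _h : Nonempty {p : X // p ∈ batch} then
    ((Finite.exists_min v).choose.1, v (Finite.exists_min v).choose)
  else q

/-- The state after the domain has been replaced by the smaller domain `(R, p)`. -/
def newDomain (R : Hyperrectangle d) (p : EuclideanSpace ℝ (Fin d) × ℝ) (err : ℝ) : State d :=
  ⟨R, p.1, p.2, err, R.outerFaces⟩

open scoped Classical in
/-- Parallel trap with accuracy `η`. Among the two ends of `R` in its longest direction `k`, take the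
one that is farther from the pivot, and query `√(r η)`-nets on the hyperplane sections of `R` at
distance `r / 6` and `r / 3` from it, where `r` is the length of the second longest direction. -/
def parallelTrap [NeZero d] (η : ℝ) (s : State d) :
    QueryProg (EuclideanSpace ℝ (Fin d)) (State d) :=
  let k := s.R.longest
  let r := s.R.otherSide k
  let fromBelow : Prop := s.R.lower k + s.R.side k / 2 ≤ s.pivot k
  let e : ℝ := if fromBelow then s.R.lower k + r / 6 else s.R.upper k - r / 6
  let g : ℝ := if fromBelow then s.R.lower k + r / 3 else s.R.upper k - r / 3
  -- the part of `R` behind the cut `c`, and the part before it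
  let behind (c : ℝ) := if fromBelow then s.R.above k c else s.R.below k c
  let before (c : ℝ) := if fromBelow then s.R.below k c else s.R.above k c
  let N := s.R.sliceNet k e √(r * η) ∪ s.R.sliceNet k g √(r * η)
  .query N fun v =>
    let y := best N v (s.pivot, s.value)
    .pure <|
      if s.value ≤ y.2 then newDomain (behind g) (s.pivot, s.value) η
      else if y.1 k = g then newDomain (behind e) y η
      else newDomain (before g) y η

open scoped Classical in
/-- Edge fixing, with growth parameter `L`, applied to a state some of whose faces are not yet known
to satisfy `P_0`. -/
def edgeFixing (L : ℝ) (s : State d) (h : s.fixedᶜ.Nonempty) :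
    QueryProg (EuclideanSpace ℝ (Fin d)) (State d) :=
  -- the face closest to the pivot among those not known to satisfy `P_0`, and its distance
  let F := (Finset.exists_min_image s.fixedᶜ (s.R.distFace s.pivot) h).choose
  let r := s.R.distFace s.pivot F
  let δ := √(s.err * r / L)
  let x₀ := (s.pivot, s.value)
  let R₁ := s.R.interBall x₀.1 (r / 3)
  .query (R₁.boundaryNet δ) fun v₁ =>
    let x₁ := best (R₁.boundaryNet δ) v₁ x₀
    let R₂ := s.R.interBall x₁.1 (r / 3)
    .query (R₂.boundaryNet δ) fun v₂ =>
      let x₂ := best (R₂.boundaryNet δ) v₂ x₁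
      let R₃ := s.R.interBall x₂.1 (r / 3)
      .query (R₃.boundaryNet δ) fun v₃ =>
        let x₃ := best (R₃.boundaryNet δ) v₃ x₂
        .pure <|
          if ¬ x₁.2 ≤ x₀.2 - s.err * r / 3 then newDomain R₁ x₀ ((1 + 1 / L) * s.err)
          else if ¬ x₂.2 ≤ x₁.2 - s.err * r / 3 then newDomain R₂ x₁ ((1 + 1 / L) * s.err)
          else if ¬ x₃.2 ≤ x₂.2 - s.err * r / 3 then newDomain R₃ x₂ ((1 + 1 / L) * s.err)
          else { s with pivot := x₃.1, value := x₃.2, fixed := insert F s.fixed }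

open scoped Classical in
/-- One step: parallel trap if all `2d` faces are known to satisfy `P_0`, edge fixing otherwise. -/
def gftStep [NeZero d] (η L : ℝ) (s : State d) :
    QueryProg (EuclideanSpace ℝ (Fin d)) (State d) :=
  if h : s.fixedᶜ.Nonempty then edgeFixing L s h else parallelTrap η s

/-- Initialisation: the domain `([0,1]^d, (1/2, …, 1/2))`; the value of the pivot is queried. -/
def gftInit (d : ℕ) (η : ℝ) : QueryProg (EuclideanSpace ℝ (Fin d)) (State d) :=
  let R : Hyperrectangle d := ⟨fun _ => 0, fun _ => 1⟩
  let x : EuclideanSpace ℝ (Fin d) := WithLp.toLp 2 fun _ => 1 / 2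
  .query {x} fun v => .pure (newDomain R (x, v ⟨x, Finset.mem_singleton_self x⟩) η)

open scoped Classical in
/-- The pivot, moved onto the faces of `R` that lie in the boundary of `[0,1]^d`. -/
def roundedPivot (s : State d) : EuclideanSpace ℝ (Fin d) :=
  WithLp.toLp 2 fun i =>
    if s.R.lower i = 0 then 0 else if s.R.upper i = 1 then 1 else s.pivot i

end GFT

/-- Gradient flow trapping on `[0,1]^d` for target accuracy `ε`. It is run with the internal accuracy
`η = ε / 4` and the growth parameter `L = 500 log (d / ε)`, and it stops as soon as the diameter of
the domain is at most `2 η`. -/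
def gradientFlowTrapping (d : ℕ) [NeZero d] (ε : ℝ) :
    GFT.ParallelAlgorithm (EuclideanSpace ℝ (Fin d)) where
  State := GFT.State d
  init := GFT.gftInit d (ε / 4)
  halted s := s.R.diam ≤ 2 * (ε / 4)
  step s := GFT.gftStep (ε / 4) (500 * Real.log (d / ε)) s
  output s := GFT.roundedPivot s

end

noncomputable section

namespace GFT

/-! ### Smooth functions on the cube -/

section Smooth

variable {d : ℕ}

/-! Let `x` be the pivot of the domain `R`. A face is trapped with slope `c` (property `P_c`,
`FaceTrap`) if it lies in the boundary of the cube or if `f` exceeds `f x - c * dist(x, face)` on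
it. If all faces are trapped, a minimiser over `R` of `f + c‖· - x‖` avoids every face that is
interior to the cube, so `R` contains a `c`-stationary point (`exists_stationary`). When `R` has
diameter at most `2η` and `c ≤ 2η`, the Lipschitz gradient transfers this to the rounded pivot at
the price of another `2η`, and `4η = ε`.

Finitely many queries control a whole face because, on a segment of length `ℓ`, a smooth `f` is
nowhere below its smaller endpoint value by more than `ℓ²/8` (`IsSmooth.exists_endpoint_le`). The
error of a net is thus quadratic in its mesh, so a mesh of order `√(rη)` suffices up to powers of
`L`; this is the source of the exponent `(d-1)/2`.

Trapping survives every step (`Invariant`). In edge fixing, three descents by `err * r / 3`, each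
moving a coordinate by at most `r / 3`, preserve `P_err`, and their total `err * r` turns `P_err`
into `P_0` on the chosen face at distance `r`. If a descent fails, the small box around the current
point is trapped with slope `(1 + 1/L) * err`. In a parallel trap all faces have `P_0`, which does
not involve distances, so the pivot may jump anywhere lower and the slope restarts at `η`. The slope
never exceeds `2η`: every failure shrinks the sides by `2/3`, so only `O(log (d/ε))` failures fit
between two restarts.

Each step fixes one of `2d` faces or removes at least `1/18` of the volume, and bounded aspect ratio
bounds the volume below until the loop stops; this gives `O(d² log (d/ε))` steps of at most three
rounds. The main part of the work of a step is proportional to at most the fourth root of the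
volume, so it sums like a geometric series and costs no factor for the number of steps. -/

theorem convex_cube : Convex ℝ (cube d) := by
  intro x hx y hy a b ha hb hab i
  obtain ⟨h1, h2⟩ := hx i
  obtain ⟨h3, h4⟩ := hy i
  simp only [PiLp.add_apply, PiLp.smul_apply, smul_eq_mul]
  constructor
  · positivity
  · nlinarith

/-- Along the segment from `y` to `p`, the quadratic model minus `f` has nonnegative derivative,
because the gradient changes by at most `t * ‖p - y‖` up to time `t`. -/
theorem descent {f : EuclideanSpace ℝ (Fin d) → ℝ}
    {g : EuclideanSpace ℝ (Fin d) → EuclideanSpace ℝ (Fin d)}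
    (hg : ∀ x ∈ cube d, HasGradientWithinAt f (g x) (cube d) x)
    (hL : ∀ x ∈ cube d, ∀ y ∈ cube d, ‖g x - g y‖ ≤ ‖x - y‖)
    {y p : EuclideanSpace ℝ (Fin d)} (hy : y ∈ cube d) (hp : p ∈ cube d) :
    f p ≤ f y + inner ℝ (g y) (p - y) + ‖p - y‖ ^ 2 / 2 := by
  set v := p - y with hv
  have hmem : ∀ t ∈ Set.Icc (0 : ℝ) 1, y + t • v ∈ cube d := fun t ht =>
    convex_cube.add_smul_sub_mem hy hp ht
  have hline : ∀ t : ℝ, HasDerivWithinAt (fun t : ℝ => y + t • v) v (Set.Icc 0 1) t := fun t => by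
    simpa using (((hasDerivAt_id t).smul_const v).const_add y).hasDerivWithinAt
  have hφ : ∀ t ∈ Set.Icc (0 : ℝ) 1, HasDerivWithinAt (fun t : ℝ => f (y + t • v))
      (inner ℝ (g (y + t • v)) v) (Set.Icc 0 1) t := fun t ht => by
    have := (hg _ (hmem t ht)).hasFDerivWithinAt.comp_hasDerivWithinAt t (hline t) hmem
    simpa [Function.comp_def] using this
  have hψ : ∀ t ∈ Set.Icc (0 : ℝ) 1, HasDerivWithinAt
      (fun t : ℝ => t * inner ℝ (g y) v + t ^ 2 / 2 * ‖v‖ ^ 2 - f (y + t • v))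
      (inner ℝ (g y) v + t * ‖v‖ ^ 2 - inner ℝ (g (y + t • v)) v) (Set.Icc 0 1) t := fun t ht => by
    have h1 : HasDerivAt (fun t : ℝ => t * inner ℝ (g y) v + t ^ 2 / 2 * ‖v‖ ^ 2)
        (inner ℝ (g y) v + t * ‖v‖ ^ 2) t := by
      have := ((hasDerivAt_id t).mul_const (inner ℝ (g y) v)).add
        ((((hasDerivAt_id t).pow 2).div_const 2).mul_const (‖v‖ ^ 2))
      refine this.congr_deriv ?_
      simp
    exact h1.hasDerivWithinAt.sub (hφ t ht)
  have hmono := monotoneOn_of_hasDerivWithinAt_nonneg (convex_Icc (0 : ℝ) 1)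
    (fun t ht => (hψ t ht).continuousWithinAt)
    (fun t ht => (hψ t (interior_subset ht)).mono interior_subset) (fun t ht => by
      have ht' := interior_subset ht
      have h1 : inner ℝ (g (y + t • v) - g y) v ≤ ‖g (y + t • v) - g y‖ * ‖v‖ :=
        real_inner_le_norm _ _
      have h2 : ‖g (y + t • v) - g y‖ ≤ t * ‖v‖ := by
        refine (hL _ (hmem t ht') _ hy).trans_eq ?_
        rw [add_sub_cancel_left, norm_smul, Real.norm_of_nonneg ht'.1]
      rw [inner_sub_left] at h1
      nlinarith [norm_nonneg v])
  have := hmono (Set.left_mem_Icc.2 zero_le_one) (Set.right_mem_Icc.2 zero_le_one) zero_le_one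
  simp only [zero_mul, zero_smul, one_mul, one_smul, add_zero, hv, add_sub_cancel] at this
  rw [hv]
  linarith

theorem IsSmooth.continuousOn {f : EuclideanSpace ℝ (Fin d) → ℝ} (hf : IsSmooth f) :
    ContinuousOn f (cube d) := by
  obtain ⟨g, hg, -⟩ := hf
  exact fun x hx => (hg x hx).hasFDerivWithinAt.continuousWithinAt

/-- Rounding one point of a segment to one of its endpoints. -/
theorem IsSmooth.exists_endpoint_le {f : EuclideanSpace ℝ (Fin d) → ℝ} (hf : IsSmooth f)
    {p q : EuclideanSpace ℝ (Fin d)} (hp : p ∈ cube d) (hq : q ∈ cube d) {t : ℝ}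
    (ht : t ∈ Set.Icc (0 : ℝ) 1) :
    f p ≤ f (p + t • (q - p)) + ‖q - p‖ ^ 2 / 8 ∨ f q ≤ f (p + t • (q - p)) + ‖q - p‖ ^ 2 / 8 := by
  obtain ⟨g, hg, hL⟩ := hf
  have hy := convex_cube.add_smul_sub_mem hp hq ht
  set y := p + t • (q - p) with hydef
  have h1 := descent hg hL hy hp
  have h2 := descent hg hL hy hq
  have e1 : p - y = (-t) • (q - p) := by rw [hydef]; module
  have e2 : q - y = (1 - t) • (q - p) := by rw [hydef]; module
  rw [e1, inner_smul_right, norm_smul, mul_pow, Real.norm_eq_abs, sq_abs] at h1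
  rw [e2, inner_smul_right, norm_smul, mul_pow, Real.norm_eq_abs, sq_abs] at h2
  by_contra! h
  -- The weights `1 - t` and `t` cancel the gradient terms; the quadratic terms average to `t(1-t)‖q
  -- - p‖²/2`, which is at most `‖q - p‖²/8`.
  have h3 := mul_le_mul_of_nonneg_left h1 (sub_nonneg.2 ht.2)
  have h4 := mul_le_mul_of_nonneg_left h2 ht.1
  have h5 : (1 - t) * (f y + ‖q - p‖ ^ 2 / 8) + t * (f y + ‖q - p‖ ^ 2 / 8) <
      (1 - t) * f p + t * f q := by
    rcases ht.1.eq_or_lt with h0 | h0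
    · rw [← h0]; linarith [h.1]
    · nlinarith [h.1, h.2, mul_lt_mul_of_pos_left h.2 h0,
        mul_le_mul_of_nonneg_left h.1.le (sub_nonneg.2 ht.2)]
  nlinarith [mul_nonneg (sq_nonneg (2 * t - 1)) (sq_nonneg ‖q - p‖)]

end Smooth

/-! ### Nets on slices of hyperrectangles -/

namespace Hyperrectangle

variable {d : ℕ}

instance : Membership (EuclideanSpace ℝ (Fin d)) (Hyperrectangle d) :=
  ⟨fun R y => ∀ i, R.lower i ≤ y i ∧ y i ≤ R.upper i⟩

/-- A hyperrectangle in the unit cube with non-empty interior. -/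
structure Proper (R : Hyperrectangle d) : Prop where
  nonneg : ∀ i, 0 ≤ R.lower i
  le_one : ∀ i, R.upper i ≤ 1
  lt : ∀ i, R.lower i < R.upper i

variable {R : Hyperrectangle d}

theorem Proper.mem_cube (hR : R.Proper) {y : EuclideanSpace ℝ (Fin d)} (hy : y ∈ R) :
    y ∈ cube d :=
  fun i => ⟨(hR.nonneg i).trans (hy i).1, (hy i).2.trans (hR.le_one i)⟩

theorem Proper.side_pos (hR : R.Proper) (i : Fin d) : 0 < R.side i := sub_pos.2 (hR.lt i)

theorem Proper.side_le_one (hR : R.Proper) (i : Fin d) : R.side i ≤ 1 := by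
  have := hR.nonneg i
  have := hR.le_one i
  rw [side]
  linarith

theorem Proper.lower_le_faceCoord (hR : R.Proper) (F : Fin d × Bool) :
    R.lower F.1 ≤ R.faceCoord F := by
  rw [faceCoord]; split
  exacts [(hR.lt _).le, le_rfl]

theorem Proper.faceCoord_le_upper (hR : R.Proper) (F : Fin d × Bool) :
    R.faceCoord F ≤ R.upper F.1 := by
  rw [faceCoord]; split
  exacts [le_rfl, (hR.lt _).le]

theorem mem_gridPoints_bounds {a b : ℝ} (hab : a ≤ b) {m : ℕ} {z : ℝ}
    (hz : z ∈ gridPoints a b m) : a ≤ z ∧ z ≤ b := by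
  classical
  simp only [gridPoints, Finset.mem_image, Finset.mem_range] at hz
  obtain ⟨i, hi, rfl⟩ := hz
  have h0 : (0 : ℝ) ≤ i / m := by positivity
  have h1 : (i : ℝ) / m ≤ 1 := div_le_one_of_le₀ (by exact_mod_cast Nat.lt_succ_iff.1 hi) (by positivity)
  rw [mul_div_assoc]
  constructor <;> nlinarith

theorem exists_gridPoints_bracket {a b : ℝ} (hab : a ≤ b) {m : ℕ} (hm : 0 < m) {z : ℝ}
    (hz : z ∈ Set.Icc a b) :
    ∃ u ∈ gridPoints a b m, ∃ w ∈ gridPoints a b m, u ≤ z ∧ z ≤ w ∧ w - u ≤ (b - a) / m := by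
  classical
  have hm' : (0 : ℝ) < m := by exact_mod_cast hm
  have key : ∀ n : ℕ, n ≤ m → z ≤ a + (b - a) * n / m →
      ∃ u ∈ gridPoints a b m, ∃ w ∈ gridPoints a b m, u ≤ z ∧ z ≤ w ∧ w - u ≤ (b - a) / m := by
    intro n
    induction n with
    | zero =>
      intro _ h
      have ha : a ∈ gridPoints a b m := by
        simp only [gridPoints, Finset.mem_image, Finset.mem_range]
        exact ⟨0, by omega, by simp⟩
      refine ⟨a, ha, a, ha, hz.1, by simpa using h, ?_⟩
      rw [sub_self]
      exact div_nonneg (sub_nonneg.2 hab) hm'.le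
    | succ n ih =>
      intro hn h
      rcases le_total z (a + (b - a) * n / m) with h' | h'
      · exact ih (by omega) h'
      · refine ⟨_, Finset.mem_image_of_mem _ (Finset.mem_range.2 (by omega : n < m + 1)), _,
          Finset.mem_image_of_mem _ (Finset.mem_range.2 (by omega : n + 1 < m + 1)), h', h, ?_⟩
        push_cast
        apply le_of_eq
        ring
  exact key m le_rfl (by rw [mul_div_assoc, div_self hm'.ne']; linarith [hz.2])

theorem mem_of_mem_sliceNet (hR : R.Proper) {k : Fin d} {c δ : ℝ} (h1 : R.lower k ≤ c)
    (h2 : c ≤ R.upper k) {p : EuclideanSpace ℝ (Fin d)} (hp : p ∈ R.sliceNet k c δ) :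
    p ∈ R ∧ p k = c := by
  classical
  simp only [sliceNet, Finset.mem_image, Fintype.mem_piFinset] at hp
  obtain ⟨q, hq, rfl⟩ := hp
  have hk : q k = c := by simpa using hq k
  refine ⟨fun i => ?_, hk⟩
  by_cases hi : i = k
  · subst hi
    simpa [hk] using ⟨h1, h2⟩
  · have := hq i
    rw [if_neg hi] at this
    exact mem_gridPoints_bounds (hR.lt i).le this

/-- The values on a slice are at least the smallest value on its net, up to `δ ^ 2 / 8`. -/
theorem exists_sliceNet_le {f : EuclideanSpace ℝ (Fin d) → ℝ} (hf : IsSmooth f) (hR : R.Proper)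
    (hd : 2 ≤ d) {k : Fin d} {δ : ℝ} (hδ : 0 < δ) {y : EuclideanSpace ℝ (Fin d)} (hy : y ∈ R) :
    ∃ p ∈ R.sliceNet k (y k) δ, f p ≤ f y + δ ^ 2 / 8 := by
  classical
  have hd1 : (0 : ℝ) < (d : ℝ) - 1 := by
    have : (2 : ℝ) ≤ d := by exact_mod_cast hd
    linarith
  -- Coordinates are rounded to the grid one at a time, `S` being those already rounded. Each moves
  -- along a segment of length at most `δ / √(d-1)`, and `d - 1` of them have to be rounded, so the
  -- total loss is `δ²/8`.
  have key : ∀ S : Finset (Fin d), ∃ p ∈ R,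
      (∀ j ∈ S, p j ∈ gridPoints (R.lower j) (R.upper j) ⌈√((d : ℝ) - 1) * R.side j / δ⌉₊) ∧
      (∀ j ∉ S, p j = y j) ∧ f p ≤ f y + S.card * (δ ^ 2 / ((d : ℝ) - 1) / 8) := by
    intro S
    induction S using Finset.induction_on with
    | empty => exact ⟨y, hy, by simp, by simp, by simp⟩
    | insert j S hj ih =>
      obtain ⟨p, hpR, hpS, hpy, hpf⟩ := ih
      set m := ⌈√((d : ℝ) - 1) * R.side j / δ⌉₊ with hm
      have hpos : 0 < √((d : ℝ) - 1) * R.side j / δ := by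
        have := hR.side_pos j
        positivity
      have hm0 : 0 < m := Nat.ceil_pos.2 hpos
      obtain ⟨u, hu, w, hw, huz, hzw, hwu⟩ :=
        exists_gridPoints_bracket (hR.lt j).le hm0 (z := p j) ⟨(hpR j).1, (hpR j).2⟩
      let q (z : ℝ) : EuclideanSpace ℝ (Fin d) := WithLp.toLp 2 (Function.update p.ofLp j z)
      have hqj : ∀ z, q z j = z := fun z => by simp [q]
      have hqi : ∀ z, ∀ i ≠ j, q z i = p i := fun z i hi => by simp [q, hi]
      have hqR : ∀ z ∈ gridPoints (R.lower j) (R.upper j) m, q z ∈ R := by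
        intro z hz i
        by_cases hi : i = j
        · subst hi
          rw [hqj]
          exact mem_gridPoints_bounds (hR.lt i).le hz
        · rw [hqi z i hi]
          exact hpR i
      have hnorm : ‖q w - q u‖ = w - u := by
        have : q w - q u = EuclideanSpace.single j (w - u) := by
          ext i
          by_cases hi : i = j
          · subst hi; simp [hqj]
          · simp [hqi _ i hi, hi]
        rw [this, PiLp.norm_single, Real.norm_of_nonneg (by linarith)]
      have hsq : ‖q w - q u‖ ^ 2 ≤ δ ^ 2 / ((d : ℝ) - 1) := by
        have hle : w - u ≤ δ / √((d : ℝ) - 1) := by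
          refine hwu.trans ?_
          have h1 : √((d : ℝ) - 1) * R.side j / δ ≤ m := Nat.le_ceil _
          have hm' : (0 : ℝ) < m := by exact_mod_cast hm0
          rw [div_le_div_iff₀ hm' (by positivity)]
          rw [div_le_iff₀ hδ, side] at h1
          linarith
        rw [hnorm]
        calc (w - u) ^ 2 ≤ (δ / √((d : ℝ) - 1)) ^ 2 := pow_le_pow_left₀ (by linarith) hle 2
          _ = _ := by rw [div_pow, Real.sq_sqrt hd1.le]
      obtain ⟨t, ht, hpt⟩ : ∃ t ∈ Set.Icc (0 : ℝ) 1, q u + t • (q w - q u) = p := by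
        have : ∃ t ∈ Set.Icc (0 : ℝ) 1, u + t * (w - u) = p j := by
          rcases (huz.trans hzw).eq_or_lt with h | h
          · exact ⟨0, by simp, by linarith⟩
          · refine ⟨(p j - u) / (w - u), ⟨by apply div_nonneg <;> linarith,
              div_le_one_of_le₀ (by linarith) (by linarith)⟩, ?_⟩
            rw [div_mul_cancel₀ _ (by linarith)]
            ring
        obtain ⟨t, ht, h⟩ := this
        refine ⟨t, ht, ?_⟩
        ext i
        by_cases hi : i = j
        · subst hi; simpa [hqj] using h
        · simp [hqi _ i hi]
      have hround := hf.exists_endpoint_le (hR.mem_cube (hqR u hu)) (hR.mem_cube (hqR w hw)) ht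
      rw [hpt] at hround
      obtain ⟨z, hz, hzf⟩ : ∃ z ∈ gridPoints (R.lower j) (R.upper j) m,
          f (q z) ≤ f p + ‖q w - q u‖ ^ 2 / 8 := hround.elim (fun h => ⟨u, hu, h⟩) fun h => ⟨w, hw, h⟩
      refine ⟨q z, hqR z hz, ?_, ?_, ?_⟩
      · intro i hi
        by_cases hij : i = j
        · subst hij
          rw [hqj]
          exact hz
        · rw [hqi z i hij]
          exact hpS i (Finset.mem_of_mem_insert_of_ne hi hij)
      · intro i hi
        rw [Finset.mem_insert, not_or] at hi
        rw [hqi z i hi.1, hpy i hi.2]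
      · rw [Finset.card_insert_of_notMem hj]
        push_cast
        linarith
  obtain ⟨p, hpR, hpS, hpy, hpf⟩ := key (Finset.univ.erase k)
  refine ⟨p, ?_, ?_⟩
  · simp only [sliceNet, Finset.mem_image, Fintype.mem_piFinset]
    refine ⟨p.ofLp, fun j => ?_, rfl⟩
    by_cases hj : j = k
    · subst hj
      simp [hpy j (by simp)]
    · rw [if_neg hj]
      exact hpS j (by simp [hj])
  · rw [Finset.card_erase_of_mem (Finset.mem_univ k), Finset.card_univ, Fintype.card_fin,
      Nat.cast_sub (by omega), Nat.cast_one] at hpf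
    have : ((d : ℝ) - 1) * (δ ^ 2 / ((d : ℝ) - 1) / 8) = δ ^ 2 / 8 := by
      field_simp
    linarith

theorem mem_of_mem_boundaryNet (hR : R.Proper) {δ : ℝ} {p : EuclideanSpace ℝ (Fin d)}
    (hp : p ∈ R.boundaryNet δ) : p ∈ R := by
  classical
  simp only [boundaryNet, Finset.mem_biUnion, Finset.mem_univ, true_and] at hp
  obtain ⟨F, hF⟩ := hp
  exact (mem_of_mem_sliceNet hR (hR.lower_le_faceCoord F) (hR.faceCoord_le_upper F) hF).1

theorem exists_boundaryNet_le {f : EuclideanSpace ℝ (Fin d) → ℝ} (hf : IsSmooth f) (hR : R.Proper)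
    (hd : 2 ≤ d) {F : Fin d × Bool} {δ : ℝ} (hδ : 0 < δ) {y : EuclideanSpace ℝ (Fin d)}
    (hy : y ∈ R) (hyF : y F.1 = R.faceCoord F) :
    ∃ p ∈ R.boundaryNet δ, f p ≤ f y + δ ^ 2 / 8 := by
  classical
  obtain ⟨p, hp, hpf⟩ := exists_sliceNet_le hf hR hd (k := F.1) hδ hy
  refine ⟨p, ?_, hpf⟩
  simp only [boundaryNet, Finset.mem_biUnion, Finset.mem_univ, true_and]
  exact ⟨F, hyF ▸ hp⟩

theorem card_gridPoints_le (a b : ℝ) (m : ℕ) : (gridPoints a b m).card ≤ m + 1 := by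
  classical
  exact Finset.card_image_le.trans_eq (Finset.card_range _)

theorem card_sliceNet_le {k : Fin d} {c δ M : ℝ} (hM : 0 ≤ M)
    (h : ∀ j ≠ k, √((d : ℝ) - 1) * R.side j / δ ≤ M) :
    ((R.sliceNet k c δ).card : ℝ) ≤ (M + 2) ^ (d - 1) := by
  classical
  have h1 : (R.sliceNet k c δ).card ≤ ∏ j, if j = k then 1 else ⌈√((d : ℝ) - 1) * R.side j / δ⌉₊ + 1 := by
    refine Finset.card_image_le.trans ?_
    rw [Fintype.card_piFinset]
    refine Finset.prod_le_prod' fun j _ => ?_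
    split
    · simp
    · exact card_gridPoints_le _ _ _
  have h2 : ((∏ j, if j = k then 1 else ⌈√((d : ℝ) - 1) * R.side j / δ⌉₊ + 1 : ℕ) : ℝ) ≤
      ∏ j, if j = k then 1 else M + 2 := by
    push_cast
    refine Finset.prod_le_prod (fun j _ => by positivity) fun j _ => ?_
    split
    · simp
    · next hj =>
      have : (⌈√((d : ℝ) - 1) * R.side j / δ⌉₊ : ℝ) ≤ ⌈M⌉₊ := by
        exact_mod_cast Nat.ceil_le_ceil (h j hj)
      have := (Nat.ceil_lt_add_one hM).le
      linarith
  have h3 : (∏ j : Fin d, if j = k then 1 else M + 2) = (M + 2) ^ (d - 1) := by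
    rw [← Finset.mul_prod_erase _ _ (Finset.mem_univ k), if_pos rfl, one_mul,
      Finset.prod_congr rfl (g := fun _ => M + 2) (fun j hj => if_neg (Finset.ne_of_mem_erase hj))]
    simp
  calc ((R.sliceNet k c δ).card : ℝ) ≤ _ := by exact_mod_cast h1
    _ ≤ _ := h2
    _ = _ := h3

theorem card_boundaryNet_le {δ M : ℝ} (hM : 0 ≤ M)
    (h : ∀ j, √((d : ℝ) - 1) * R.side j / δ ≤ M) :
    ((R.boundaryNet δ).card : ℝ) ≤ 2 * d * (M + 2) ^ (d - 1) := by
  classical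
  calc ((R.boundaryNet δ).card : ℝ)
      ≤ ∑ F : Fin d × Bool, ((R.sliceNet F.1 (R.faceCoord F) δ).card : ℝ) := by
        exact_mod_cast Finset.card_biUnion_le
    _ ≤ ∑ _F : Fin d × Bool, (M + 2) ^ (d - 1) :=
        Finset.sum_le_sum fun F _ => card_sliceNet_le hM fun j _ => h j
    _ = _ := by simp [mul_comm]

end Hyperrectangle

theorem best_spec {X : Type} (f : X → ℝ) {batch : Finset X} (h : batch.Nonempty) (q : X × ℝ) :
    (best batch (fun p => f p.1) q).1 ∈ batch ∧
      (best batch (fun p => f p.1) q).2 = f (best batch (fun p => f p.1) q).1 ∧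
      ∀ p ∈ batch, (best batch (fun p => f p.1) q).2 ≤ f p := by
  classical
  have hne : Nonempty {p : X // p ∈ batch} := h.to_subtype
  rw [best, dif_pos hne]
  exact ⟨Subtype.property _, rfl, fun p hp =>
    (Finite.exists_min fun p : {p : X // p ∈ batch} => f p.1).choose_spec ⟨p, hp⟩⟩

/-! ### Volume, sides and trapped faces of hyperrectangles. -/

namespace Hyperrectangle

variable {d : ℕ} {R R' : Hyperrectangle d}

/-- The volume of a hyperrectangle. -/
def vol (R : Hyperrectangle d) : ℝ := ∏ i, R.side i

theorem Proper.vol_pos (hR : R.Proper) : 0 < R.vol := Finset.prod_pos fun i _ => hR.side_pos i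

theorem vol_le_mul_vol (h0 : ∀ i, 0 ≤ R'.side i) (h1 : ∀ i, R'.side i ≤ R.side i) {k : Fin d}
    {c : ℝ} (hk : R'.side k ≤ c * R.side k) : R'.vol ≤ c * R.vol := by
  rw [vol, vol, ← Finset.mul_prod_erase _ _ (Finset.mem_univ k),
    ← Finset.mul_prod_erase _ R.side (Finset.mem_univ k), ← mul_assoc]
  exact mul_le_mul hk (Finset.prod_le_prod (fun i _ => h0 i) fun i _ => h1 i)
    (Finset.prod_nonneg fun i _ => h0 i) ((h0 k).trans hk)

theorem mem_outerFaces {F : Fin d × Bool} :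
    F ∈ R.outerFaces ↔ R.faceCoord F = if F.2 then 1 else 0 := by
  simp [outerFaces]

theorem diam_le {c : ℝ} (h0 : ∀ i, 0 ≤ R.side i) (hc : 0 ≤ c) (h : ∀ i, R.side i ≤ c) :
    R.diam ≤ √d * c := by
  rw [diam, Real.sqrt_le_left (by positivity), mul_pow, Real.sq_sqrt (by positivity)]
  calc ∑ i, R.side i ^ 2 ≤ ∑ _i : Fin d, c ^ 2 :=
        Finset.sum_le_sum fun i _ => pow_le_pow_left₀ (h0 i) (h i) 2
    _ = _ := by simp

theorem side_le_longest [NeZero d] (R : Hyperrectangle d) (i : Fin d) :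
    R.side i ≤ R.side R.longest :=
  (Finite.exists_max R.side).choose_spec i

theorem side_le_otherSide {k j : Fin d} (hj : j ≠ k) : R.side j ≤ R.otherSide k :=
  le_ciSup (f := fun j : {j : Fin d // j ≠ k} => R.side j) (Set.finite_range _).bddAbove ⟨j, hj⟩

theorem exists_side_eq_otherSide (hd : 2 ≤ d) (k : Fin d) :
    ∃ j ≠ k, R.side j = R.otherSide k := by
  have : Nontrivial (Fin d) := Fin.nontrivial_iff_two_le.2 hd
  obtain ⟨j, hj⟩ := exists_ne k
  have : Nonempty {j : Fin d // j ≠ k} := ⟨⟨j, hj⟩⟩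
  obtain ⟨i, hi⟩ := exists_eq_ciSup_of_finite (f := fun j : {j : Fin d // j ≠ k} => R.side j)
  exact ⟨i.1, i.2, hi⟩

theorem distFace_le_side {x : EuclideanSpace ℝ (Fin d)} (hx : x ∈ R) (F : Fin d × Bool) :
    R.distFace x F ≤ R.side F.1 := by
  obtain ⟨h1, h2⟩ := hx F.1
  rw [distFace, faceCoord, side, abs_le]
  split <;> constructor <;> linarith

theorem distFace_le_add (x y : EuclideanSpace ℝ (Fin d)) (F : Fin d × Bool) :
    R.distFace x F ≤ R.distFace y F + |x F.1 - y F.1| := by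
  rw [distFace, distFace, add_comm]
  exact abs_sub_le _ _ _

/-- The face `F` of `R` satisfies `P_c` with respect to the pivot `x`. -/
def FaceTrap (f : EuclideanSpace ℝ (Fin d) → ℝ) (R : Hyperrectangle d) (c : ℝ)
    (x : EuclideanSpace ℝ (Fin d)) (F : Fin d × Bool) : Prop :=
  F ∉ R.outerFaces → ∀ y ∈ R, y F.1 = R.faceCoord F → f x < f y + c * R.distFace x F

section FaceTrap

variable {f : EuclideanSpace ℝ (Fin d) → ℝ} {c c' : ℝ} {x x' : EuclideanSpace ℝ (Fin d)}
  {F : Fin d × Bool}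

theorem FaceTrap.mono (h : R.FaceTrap f c x F) (hc : c ≤ c') : R.FaceTrap f c' x F :=
  fun hF y hy hyF => (h hF y hy hyF).trans_le
    (by gcongr; exact abs_nonneg _)

/-- The distance to the face drops by at most `ρ`, and the descent pays for this. For `c = 0` any
move to a point that is not higher is allowed, however far. -/
theorem FaceTrap.move (h : R.FaceTrap f c x F) (hc : 0 ≤ c) {ρ : ℝ} (hx : |x F.1 - x' F.1| ≤ ρ)
    (hf : f x' ≤ f x - c * ρ) : R.FaceTrap f c x' F := by
  intro hF y hy hyF
  have h1 := h hF y hy hyF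
  have h2 := mul_le_mul_of_nonneg_left ((R.distFace_le_add x x' F).trans
    (add_le_add_right hx _)) hc
  linarith

/-- A descent by the full allowance `c * dist` leaves the face above the new pivot, wherever that
pivot lies. -/
theorem FaceTrap.fix (h : R.FaceTrap f c x F) (hf : f x' ≤ f x - c * R.distFace x F) :
    R.FaceTrap f 0 x' F := by
  intro hF y hy hyF
  have h1 := h hF y hy hyF
  linarith

/-- A face of a smaller hyperrectangle that is contained in a face of the larger one inherits
`P_c`. -/
theorem FaceTrap.restrict (h : R.FaceTrap f c x F) (hsub : ∀ y ∈ R', y ∈ R)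
    (hF : R'.faceCoord F = R.faceCoord F) : R'.FaceTrap f c x F := by
  intro hF' y hy hyF
  rw [distFace, hF]
  exact h (fun h => hF' (mem_outerFaces.2 (hF.trans (mem_outerFaces.1 h)))) y (hsub y hy)
    (hyF.trans hF)

end FaceTrap

theorem Proper.of_le (hR : R.Proper) (hl : ∀ i, R.lower i ≤ R'.lower i)
    (hu : ∀ i, R'.upper i ≤ R.upper i) (hlt : ∀ i, R'.lower i < R'.upper i) : R'.Proper :=
  ⟨fun i => (hR.nonneg i).trans (hl i), fun i => (hu i).trans (hR.le_one i), hlt⟩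

section InterBall

variable {x : EuclideanSpace ℝ (Fin d)} {ρ : ℝ}

theorem side_interBall_le_side (i : Fin d) : (R.interBall x ρ).side i ≤ R.side i :=
  sub_le_sub (min_le_left _ _) (le_max_left _ _)

theorem side_interBall_le (i : Fin d) : (R.interBall x ρ).side i ≤ 2 * ρ := by
  have h1 : min (R.upper i) (x i + ρ) ≤ x i + ρ := min_le_right _ _
  have h2 : x i - ρ ≤ max (R.lower i) (x i - ρ) := le_max_right _ _
  simp only [side, interBall]
  linarith

theorem le_side_interBall (hx : x ∈ R) (hρ : 0 ≤ ρ) (i : Fin d) :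
    R.side i ≤ (R.interBall x ρ).side i ∨ ρ ≤ (R.interBall x ρ).side i := by
  obtain ⟨h1, h2⟩ := hx i
  simp only [side, interBall]
  rcases min_cases (R.upper i) (x i + ρ) with ⟨e1, _⟩ | ⟨e1, _⟩ <;>
    rcases max_cases (R.lower i) (x i - ρ) with ⟨e2, _⟩ | ⟨e2, _⟩ <;> rw [e1, e2]
  · exact .inl le_rfl
  all_goals right; linarith

theorem Proper.interBall (hR : R.Proper) (hx : x ∈ R) (hρ : 0 < ρ) :
    (R.interBall x ρ).Proper := by
  refine hR.of_le (fun i => le_max_left _ _) (fun i => min_le_left _ _) fun i => ?_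
  have := hR.side_pos i
  have : 0 < (R.interBall x ρ).side i := by
    rcases R.le_side_interBall hx hρ.le i with h | h <;> linarith
  exact sub_pos.1 this

theorem mem_of_mem_interBall {y : EuclideanSpace ℝ (Fin d)} (hy : y ∈ R.interBall x ρ) : y ∈ R :=
  fun i => ⟨(le_max_left _ _).trans (hy i).1, (hy i).2.trans (min_le_left _ _)⟩

theorem abs_sub_le_of_mem_interBall {y : EuclideanSpace ℝ (Fin d)} (hy : y ∈ R.interBall x ρ)
    (i : Fin d) : |x i - y i| ≤ ρ := by
  have h1 : x i - ρ ≤ y i := (le_max_right _ _).trans (hy i).1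
  have h2 : y i ≤ x i + ρ := (hy i).2.trans (min_le_right _ _)
  rw [abs_le]
  constructor <;> linarith

theorem self_mem_interBall (hx : x ∈ R) (hρ : 0 ≤ ρ) : x ∈ R.interBall x ρ :=
  fun i => ⟨max_le (hx i).1 (by linarith), le_min (hx i).2 (by linarith)⟩

/-- The dichotomy behind shrinking: an old face inherits its trap, and a new one is at distance
exactly `ρ` from the centre. -/
theorem faceCoord_interBall (hρ : 0 ≤ ρ) (F : Fin d × Bool) :
    (R.interBall x ρ).faceCoord F = R.faceCoord F ∨ (R.interBall x ρ).distFace x F = ρ := by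
  obtain ⟨i, _ | _⟩ := F <;> simp only [distFace, faceCoord, Hyperrectangle.interBall, if_true,
    Bool.false_eq_true, if_false]
  · rcases max_choice (R.lower i) (x i - ρ) with h | h <;> rw [h]
    · exact .inl rfl
    · right; rw [sub_sub_cancel, abs_of_nonneg hρ]
  · rcases min_choice (R.upper i) (x i + ρ) with h | h <;> rw [h]
    · exact .inl rfl
    · right; rw [sub_add_cancel_left, abs_neg, abs_of_nonneg hρ]

end InterBall

end Hyperrectangle

/-! ### The invariant and its preservation by one step. -/

open Hyperrectangle

variable {d : ℕ}

/-- The invariant of gradient flow trapping. -/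
structure Invariant (f : EuclideanSpace ℝ (Fin d) → ℝ) (η L : ℝ) (s : State d) : Prop where
  proper : s.R.Proper
  aspect : ∀ i j, s.R.side i ≤ 3 * s.R.side j
  mem : s.pivot ∈ s.R
  value : s.value = f s.pivot
  le_err : η ≤ s.err
  err_le : s.err ≤ 2 * η
  -- Here `n` stands for the number of failed edge fixings since the last parallel trap, which
  -- resets it to `0`. Tying the slope to the side lengths is what bounds `n`.
  growth : ∃ n : ℕ, s.err ≤ η * (1 + 1 / L) ^ n ∧ ∀ i, s.R.side i ≤ (2 / 3) ^ n
  trap : ∀ F, s.R.FaceTrap f s.err s.pivot F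
  fixed : ∀ F ∈ s.fixed, s.R.FaceTrap f 0 s.pivot F
  outer : s.R.outerFaces ⊆ s.fixed

/-- Either one more face is fixed, or the volume of the domain shrinks by a constant factor. -/
def Advances (s s' : State d) : Prop :=
  -- A parallel trap removes a slab of thickness at least `r / 6` from a side of length at most `3 *
  -- r`; a failed edge fixing reduces some side by the better factor `2/3`.
  (s'.R = s.R ∧ s'.fixed.card = s.fixed.card + 1) ∨ s'.R.vol ≤ 17 / 18 * s.R.vol

variable {f : EuclideanSpace ℝ (Fin d) → ℝ} {η L : ℝ} {s : State d}

theorem Invariant.exists_lt_side (h : Invariant f η L s) (hη : 0 < η) (hd : 2 ≤ d)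
    (hs : ¬ s.R.diam ≤ 2 * η) : ∃ j, 2 * η < √d * s.R.side j := by
  by_contra! hc
  apply hs
  have hd' : (0 : ℝ) < √d := Real.sqrt_pos.2 (by exact_mod_cast (by omega : 0 < d))
  have := diam_le (R := s.R) (c := 2 * η / √d) (fun i => (h.proper.side_pos i).le) (by positivity)
    fun i => by rw [le_div_iff₀ hd', mul_comm]; exact hc i
  rwa [mul_div_cancel₀ _ hd'.ne'] at this

/-- Cutting the domain orthogonally to a longest direction. -/
theorem Invariant.cut (h : Invariant f η L s) (hη : 0 < η) {R' : Hyperrectangle d} {k : Fin d}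
    {p : EuclideanSpace ℝ (Fin d)} (hR' : ∀ i ≠ k, R'.lower i = s.R.lower i ∧
      R'.upper i = s.R.upper i) (hl : s.R.lower k ≤ R'.lower k) (hu : R'.upper k ≤ s.R.upper k)
    (hlt : R'.lower k < R'.upper k) (hk : R'.side k ≤ 17 / 18 * s.R.side k)
    (hj : ∀ j ≠ k, s.R.side j ≤ 3 * R'.side k) (hp : p ∈ R')
    (hP : ∀ F, s.R.FaceTrap f 0 p F) (b : Bool)
    (hb : R'.faceCoord (k, !b) = s.R.faceCoord (k, !b)) (hnew : R'.FaceTrap f η p (k, b)) :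
    Invariant f η L (newDomain R' (p, f p) η) ∧ Advances s (newDomain R' (p, f p) η) := by
  have hl' : ∀ i, s.R.lower i ≤ R'.lower i := fun i => by
    by_cases hi : i = k
    · rwa [hi]
    · exact (hR' i hi).1.ge
  have hu' : ∀ i, R'.upper i ≤ s.R.upper i := fun i => by
    by_cases hi : i = k
    · rwa [hi]
    · exact (hR' i hi).2.le
  have hlt' : ∀ i, R'.lower i < R'.upper i := fun i => by
    by_cases hi : i = k
    · rwa [hi]
    · rw [(hR' i hi).1, (hR' i hi).2]; exact h.proper.lt i
  have hproper := h.proper.of_le hl' hu' hlt'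
  have hside : ∀ i, R'.side i ≤ s.R.side i := fun i => sub_le_sub (hu' i) (hl' i)
  have hside' : ∀ i ≠ k, R'.side i = s.R.side i := fun i hi => by
    rw [side, side, (hR' i hi).1, (hR' i hi).2]
  have hsub : ∀ y ∈ R', y ∈ s.R := fun y hy i => ⟨(hl' i).trans (hy i).1, (hy i).2.trans (hu' i)⟩
  refine ⟨⟨hproper, fun i j => ?_, hp, rfl, le_rfl, ?_, ⟨0, by simp [newDomain], fun i => ?_⟩, ?_, ?_,
    le_rfl⟩, .inr ?_⟩
  · change R'.side i ≤ 3 * R'.side j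
    by_cases hjk : j = k
    · subst hjk
      by_cases hi : i = j
      · subst hi
        linarith [hproper.side_pos i]
      · rw [hside' i hi]
        exact hj i hi
    · rw [hside' j hjk]
      exact (hside i).trans (h.aspect i j)
  · change η ≤ 2 * η
    linarith
  · simpa [newDomain] using hproper.side_le_one i
  · rintro ⟨i, b'⟩
    change R'.FaceTrap f η p (i, b')
    by_cases hi : i = k
    · subst hi
      by_cases hbb : b' = b
      · rwa [hbb]
      · have : b' = !b := by cases b <;> cases b' <;> simp_all
        subst this
        exact ((hP _).restrict hsub hb).mono hη.le
    · refine ((hP _).restrict hsub ?_).mono hη.le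
      simp [faceCoord, hR' i hi]
  · intro F hF hF'
    exact absurd hF hF'
  · exact vol_le_mul_vol (fun i => (hproper.side_pos i).le) hside hk

/-- The net error `r * η / 8` is less than the allowance `η * r / 6` on the new face, since in each
of the three outcomes the pivot is at distance at least `r / 6` from the cut. The other faces keep
`P_0`. -/
theorem Invariant.parallelTrap [NeZero d] (hf : IsSmooth f) (hd : 2 ≤ d) (hη : 0 < η)
    (h : Invariant f η L s) (hs : ∀ F, F ∈ s.fixed) :
    Invariant f η L ((parallelTrap η s).result f) ∧
      Advances s ((GFT.parallelTrap η s).result f) := by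
  classical
  simp only [GFT.parallelTrap, QueryProg.result]
  have hmax := s.R.side_le_longest
  set k := s.R.longest
  obtain ⟨j, hjk, hjr⟩ := s.R.exists_side_eq_otherSide hd k
  have hother : ∀ i ≠ k, s.R.side i ≤ s.R.otherSide k := fun i hi => side_le_otherSide hi
  set r := s.R.otherSide k
  have hr0 : 0 < r := hjr ▸ h.proper.side_pos j
  have hrl : r ≤ s.R.side k := hjr ▸ hmax j
  have hlr : s.R.side k ≤ 3 * r := hjr ▸ h.aspect k j
  have hside : s.R.side k = s.R.upper k - s.R.lower k := rfl
  set u : ℝ := if s.R.lower k + s.R.side k / 2 ≤ s.pivot k then s.R.lower k + r / 6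
    else s.R.upper k - r / 6 with hu
  set w : ℝ := if s.R.lower k + s.R.side k / 2 ≤ s.pivot k then s.R.lower k + r / 3
    else s.R.upper k - r / 3 with hw
  have hu1 : s.R.lower k ≤ u ∧ u ≤ s.R.upper k := by
    rw [hu]; split <;> constructor <;> linarith
  have hw1 : s.R.lower k ≤ w ∧ w ≤ s.R.upper k := by
    rw [hw]; split <;> constructor <;> linarith
  have huw : u ≠ w := by
    rw [hu, hw]; split <;> intro h <;> linarith
  have hδ : 0 < √(r * η) := by positivity
  have hδ2 : √(r * η) ^ 2 = r * η := Real.sq_sqrt (by positivity)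
  have hne : (s.R.sliceNet k u √(r * η) ∪ s.R.sliceNet k w √(r * η)).Nonempty := by
    have hmem : WithLp.toLp 2 (Function.update s.pivot.ofLp k u) ∈ s.R := fun i => by
      by_cases hi : i = k
      · subst hi; simpa using hu1
      · simpa [hi] using h.mem i
    obtain ⟨p, hp, -⟩ := exists_sliceNet_le hf h.proper hd (k := k) hδ hmem
    exact ⟨p, Finset.mem_union_left _ (by simpa using hp)⟩
  obtain ⟨hbmem, hbval, hbmin⟩ := best_spec f hne (s.pivot, s.value)
  set y := best (s.R.sliceNet k u √(r * η) ∪ s.R.sliceNet k w √(r * η)) (fun p => f p.1)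
    (s.pivot, s.value)
  have hyu : ∀ z ∈ s.R, z k = u → y.2 ≤ f z + r * η / 8 := fun z hz hzk => by
    obtain ⟨p, hp, hpz⟩ := exists_sliceNet_le hf h.proper hd (k := k) hδ hz
    rw [hzk] at hp
    rw [hδ2] at hpz
    exact (hbmin p (Finset.mem_union_left _ hp)).trans hpz
  have hyw : ∀ z ∈ s.R, z k = w → y.2 ≤ f z + r * η / 8 := fun z hz hzk => by
    obtain ⟨p, hp, hpz⟩ := exists_sliceNet_le hf h.proper hd (k := k) hδ hz
    rw [hzk] at hp
    rw [hδ2] at hpz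
    exact (hbmin p (Finset.mem_union_right _ hp)).trans hpz
  have hrη : r * η / 8 < r * η / 6 := by
    have := mul_pos hr0 hη
    linarith
  have hyR : y.1 ∈ s.R ∧ (y.1 k = u ∨ y.1 k = w) := by
    rcases Finset.mem_union.1 hbmem with h' | h'
    · exact ⟨(mem_of_mem_sliceNet h.proper hu1.1 hu1.2 h').1,
        .inl (mem_of_mem_sliceNet h.proper hu1.1 hu1.2 h').2⟩
    · exact ⟨(mem_of_mem_sliceNet h.proper hw1.1 hw1.2 h').1,
        .inr (mem_of_mem_sliceNet h.proper hw1.1 hw1.2 h').2⟩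
  have hyy : y = (y.1, f y.1) := Prod.ext rfl hbval
  have hx : (s.pivot, s.value) = (s.pivot, f s.pivot) := by rw [h.value]
  have hP : ∀ F, s.R.FaceTrap f 0 s.pivot F := fun F => h.fixed F (hs F)
  have hPy : ¬ s.value ≤ y.2 → ∀ F, s.R.FaceTrap f 0 y.1 F := fun hlt F =>
    (hP F).move le_rfl le_rfl (by rw [← h.value, ← hbval]; linarith)
  -- The lower bound on `c` gives the loss of volume; the upper bound leaves thickness at least `r /
  -- 3`, which keeps the aspect ratio at most `3`.
  have cutAbove : ∀ (c : ℝ) (p : EuclideanSpace ℝ (Fin d)), s.R.lower k + r / 6 ≤ c →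
      c ≤ s.R.upper k - r / 3 → p ∈ s.R → c ≤ p k → (∀ F, s.R.FaceTrap f 0 p F) →
      (∀ z ∈ s.R, z k = c → f p < f z + η * (p k - c)) →
      Invariant f η L (newDomain (s.R.above k c) (p, f p) η) ∧
        Advances s (newDomain (s.R.above k c) (p, f p) η) := by
    intro c p hc1 hc2 hpR hpc hPp hnew
    have e1 : (s.R.above k c).lower k = c := by simp [above]
    have e2 : (s.R.above k c).upper k = s.R.upper k := rfl
    have e3 : ∀ i ≠ k, (s.R.above k c).lower i = s.R.lower i := fun i hi => by simp [above, hi]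
    have hsub : ∀ z ∈ s.R.above k c, z ∈ s.R := fun z hz i => by
      by_cases hi : i = k
      · subst hi
        have := hz k
        rw [e1, e2] at this
        exact ⟨by linarith [this.1], this.2⟩
      · have := hz i
        rwa [e3 i hi] at this
    refine h.cut hη (k := k) (fun i hi => ⟨e3 i hi, rfl⟩) ?_ le_rfl ?_ ?_ ?_ ?_ hPp false rfl ?_
    · rw [e1]; linarith
    · rw [e1, e2]; linarith
    · rw [side, e1, e2]; linarith
    · intro i hi
      rw [side.eq_1 (s.R.above k c), e1, e2]
      linarith [hother i hi]
    · intro i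
      by_cases hi : i = k
      · subst hi
        rw [e1, e2]
        exact ⟨hpc, (hpR k).2⟩
      · rw [e3 i hi]
        exact hpR i
    · intro _ z hz hzF
      have e4 : (s.R.above k c).faceCoord (k, false) = c := e1
      rw [distFace, e4, abs_of_nonneg (sub_nonneg.2 hpc)]
      exact hnew z (hsub z hz) (hzF.trans e4)
  have cutBelow : ∀ (c : ℝ) (p : EuclideanSpace ℝ (Fin d)), s.R.lower k + r / 3 ≤ c →
      c ≤ s.R.upper k - r / 6 → p ∈ s.R → p k ≤ c → (∀ F, s.R.FaceTrap f 0 p F) →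
      (∀ z ∈ s.R, z k = c → f p < f z + η * (c - p k)) →
      Invariant f η L (newDomain (s.R.below k c) (p, f p) η) ∧
        Advances s (newDomain (s.R.below k c) (p, f p) η) := by
    intro c p hc1 hc2 hpR hpc hPp hnew
    have e1 : (s.R.below k c).upper k = c := by simp [below]
    have e2 : (s.R.below k c).lower k = s.R.lower k := rfl
    have e3 : ∀ i ≠ k, (s.R.below k c).upper i = s.R.upper i := fun i hi => by simp [below, hi]
    have hsub : ∀ z ∈ s.R.below k c, z ∈ s.R := fun z hz i => by
      by_cases hi : i = k
      · subst hi
        have := hz k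
        rw [e1, e2] at this
        exact ⟨this.1, by linarith [this.2]⟩
      · have := hz i
        rwa [e3 i hi] at this
    refine h.cut hη (k := k) (fun i hi => ⟨rfl, e3 i hi⟩) le_rfl ?_ ?_ ?_ ?_ ?_ hPp true rfl ?_
    · rw [e1]; linarith
    · rw [e1, e2]; linarith
    · rw [side, e1, e2]; linarith
    · intro i hi
      rw [side.eq_1 (s.R.below k c), e1, e2]
      linarith [hother i hi]
    · intro i
      by_cases hi : i = k
      · subst hi
        rw [e1, e2]
        exact ⟨(hpR k).1, hpc⟩
      · rw [e3 i hi]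
        exact hpR i
    · intro _ z hz hzF
      have e4 : (s.R.below k c).faceCoord (k, true) = c := e1
      rw [distFace, e4, abs_sub_comm, abs_of_nonneg (sub_nonneg.2 hpc)]
      exact hnew z (hsub z hz) (hzF.trans e4)
  by_cases hB : s.R.lower k + s.R.side k / 2 ≤ s.pivot k
  · rw [if_pos hB] at hu hw
    simp only [if_pos hB]
    split_ifs with h1 h2
    · rw [hx]
      -- The pivot is in the far half, hence at least `r / 2` from the end, and the cut is at `r /
      -- 3`.
      have hdist : r / 6 ≤ s.pivot k - w := by linarith
      refine cutAbove w s.pivot (by linarith) (by linarith) h.mem (by linarith) hP fun z hz hzk => ?_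
      have := hyw z hz hzk
      have := mul_le_mul_of_nonneg_left hdist hη.le
      linarith [h.value]
    · rw [hyy]
      refine cutAbove u y.1 (by linarith) (by linarith) hyR.1 (by linarith) (hPy h1)
        fun z hz hzk => ?_
      have := hyu z hz hzk
      rw [h2, ← hbval]
      have : w - u = r / 6 := by linarith
      rw [this]
      linarith
    · rw [hyy]
      have h3 := hyR.2.resolve_right h2
      refine cutBelow w y.1 (by linarith) (by linarith) hyR.1 (by linarith) (hPy h1)
        fun z hz hzk => ?_
      have := hyw z hz hzk
      rw [h3, ← hbval]
      have : w - u = r / 6 := by linarith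
      rw [this]
      linarith
  · rw [if_neg hB] at hu hw
    simp only [if_neg hB]
    split_ifs with h1 h2
    · rw [hx]
      have hdist : r / 6 ≤ w - s.pivot k := by linarith
      refine cutBelow w s.pivot (by linarith) (by linarith) h.mem (by linarith) hP fun z hz hzk => ?_
      have := hyw z hz hzk
      have := mul_le_mul_of_nonneg_left hdist hη.le
      linarith [h.value]
    · rw [hyy]
      refine cutBelow u y.1 (by linarith) (by linarith) hyR.1 (by linarith) (hPy h1)
        fun z hz hzk => ?_
      have := hyu z hz hzk
      rw [h2, ← hbval]
      have : u - w = r / 6 := by linarith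
      rw [this]
      linarith
    · rw [hyy]
      have h3 := hyR.2.resolve_right h2
      refine cutAbove w y.1 (by linarith) (by linarith) hyR.1 (by linarith) (hPy h1)
        fun z hz hzk => ?_
      have := hyw z hz hzk
      rw [h3, ← hbval]
      have : u - w = r / 6 := by linarith
      rw [this]
      linarith

/-- One of the three rounds of edge fixing. -/
def probe (f : EuclideanSpace ℝ (Fin d) → ℝ) (R : Hyperrectangle d) (ρ δ : ℝ)
    (x : EuclideanSpace ℝ (Fin d) × ℝ) : EuclideanSpace ℝ (Fin d) × ℝ :=
  best ((R.interBall x.1 ρ).boundaryNet δ) (fun p => f p.1) x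

open scoped Classical in
theorem edgeFixing_result (f : EuclideanSpace ℝ (Fin d) → ℝ) (L : ℝ) (s : State d)
    (h : s.fixedᶜ.Nonempty) : ∃ F ∉ s.fixed, ∃ r δ x₁ x₂ x₃, r = s.R.distFace s.pivot F ∧
      δ = √(s.err * r / L) ∧ x₁ = probe f s.R (r / 3) δ (s.pivot, s.value) ∧
      x₂ = probe f s.R (r / 3) δ x₁ ∧ x₃ = probe f s.R (r / 3) δ x₂ ∧
      (edgeFixing L s h).result f =
        if ¬ x₁.2 ≤ s.value - s.err * r / 3 then
          newDomain (s.R.interBall s.pivot (r / 3)) (s.pivot, s.value) ((1 + 1 / L) * s.err)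
        else if ¬ x₂.2 ≤ x₁.2 - s.err * r / 3 then
          newDomain (s.R.interBall x₁.1 (r / 3)) x₁ ((1 + 1 / L) * s.err)
        else if ¬ x₃.2 ≤ x₂.2 - s.err * r / 3 then
          newDomain (s.R.interBall x₂.1 (r / 3)) x₂ ((1 + 1 / L) * s.err)
        else { s with pivot := x₃.1, value := x₃.2, fixed := insert F s.fixed } :=
  ⟨_, Finset.mem_compl.1 (Finset.exists_min_image s.fixedᶜ (s.R.distFace s.pivot) h).choose_spec.1,
    _, _, _, _, _, rfl, rfl, rfl, rfl, rfl, rfl⟩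

theorem probe_spec (hf : IsSmooth f) (hd : 2 ≤ d) {R : Hyperrectangle d} (hR : R.Proper)
    {ρ δ : ℝ} (hρ : 0 < ρ) (hδ : 0 < δ) {x : EuclideanSpace ℝ (Fin d) × ℝ} (hx : x.1 ∈ R) :
    (probe f R ρ δ x).1 ∈ R ∧ (∀ i, |x.1 i - (probe f R ρ δ x).1 i| ≤ ρ) ∧
      (probe f R ρ δ x).2 = f (probe f R ρ δ x).1 ∧
      ∀ F, ∀ y ∈ R.interBall x.1 ρ, y F.1 = (R.interBall x.1 ρ).faceCoord F →
        (probe f R ρ δ x).2 ≤ f y + δ ^ 2 / 8 := by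
  have hB := hR.interBall hx hρ
  have hne : ((R.interBall x.1 ρ).boundaryNet δ).Nonempty := by
    let i : Fin d := ⟨0, by omega⟩
    have hmem : (WithLp.toLp 2 (R.interBall x.1 ρ).lower : EuclideanSpace ℝ (Fin d)) ∈
        R.interBall x.1 ρ := fun j => ⟨le_rfl, (hB.lt j).le⟩
    obtain ⟨p, hp, -⟩ := exists_boundaryNet_le hf hB hd (F := (i, false)) hδ hmem rfl
    exact ⟨p, hp⟩
  obtain ⟨h1, h2, h3⟩ := best_spec f hne x
  have h4 := mem_of_mem_boundaryNet hB h1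
  refine ⟨mem_of_mem_interBall h4, abs_sub_le_of_mem_interBall h4, h2, fun F y hy hyF => ?_⟩
  obtain ⟨p, hp, hpy⟩ := exists_boundaryNet_le hf hB hd hδ hy hyF
  exact (h3 p hp).trans hpy

/-- If a round of edge fixing makes no sufficient progress, the domain shrinks to a small box around
the current point. -/
theorem Invariant.shrink (h : Invariant f η L s) (hf : IsSmooth f) (hd : 2 ≤ d) (hη : 0 < η)
    (hL : 0 < L) (hH : ∀ n : ℕ, 2 * η < √d * (2 / 3) ^ n → (1 + 1 / L) ^ (n + 1) ≤ 2)
    (hs : ¬ s.R.diam ≤ 2 * η) {F : Fin d × Bool} {r δ : ℝ} (hr : 0 < r)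
    (hrF : r = s.R.distFace s.pivot F) (hδ : δ = √(s.err * r / L))
    {x : EuclideanSpace ℝ (Fin d) × ℝ} (hx : x.1 ∈ s.R) (hxf : x.2 = f x.1)
    (hx' : ∀ F, s.R.FaceTrap f s.err x.1 F)
    (hfail : ¬ (probe f s.R (r / 3) δ x).2 ≤ x.2 - s.err * r / 3) :
    Invariant f η L (newDomain (s.R.interBall x.1 (r / 3)) x ((1 + 1 / L) * s.err)) ∧
      Advances s (newDomain (s.R.interBall x.1 (r / 3)) x ((1 + 1 / L) * s.err)) := by
  have hρ : 0 < r / 3 := by linarith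
  have herr : 0 < s.err := hη.trans_le h.le_err
  have hδ0 : 0 < δ := by rw [hδ]; positivity
  have hδ2 : δ ^ 2 = s.err * r / L := by rw [hδ, Real.sq_sqrt (by positivity)]
  have hB := h.proper.interBall hx hρ
  have hspec := (probe_spec hf hd h.proper hρ hδ0 hx).2.2.2
  have hrside : r ≤ s.R.side F.1 := hrF ▸ distFace_le_side h.mem F
  have hL1 : 0 < 1 / L := by positivity
  have herr' : s.err ≤ (1 + 1 / L) * s.err := by nlinarith
  obtain ⟨n, hn1, hn2⟩ := h.growth
  have hgrow : (1 + 1 / L) * s.err ≤ η * (1 + 1 / L) ^ (n + 1) := by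
    rw [pow_succ, ← mul_assoc, mul_comm (1 + 1 / L)]
    gcongr
  obtain ⟨j, hj⟩ := h.exists_lt_side hη hd hs
  refine ⟨⟨hB, fun i j => ?_, self_mem_interBall hx hρ.le, hxf, h.le_err.trans herr', ?_,
    ⟨n + 1, hgrow, fun i => ?_⟩, fun F' => ?_, ?_, le_rfl⟩, .inr ?_⟩
  · change (s.R.interBall x.1 (r / 3)).side i ≤ 3 * (s.R.interBall x.1 (r / 3)).side j
    have h1 := s.R.side_interBall_le_side (x := x.1) (ρ := r / 3) i
    have h2 := s.R.side_interBall_le (x := x.1) (ρ := r / 3) i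
    have h3 := h.aspect i j
    -- A side left uncut inherits the old ratio; a cut side is at least `r / 3`, while every side is
    -- at most `2 * r / 3`.
    rcases le_side_interBall hx hρ.le j with h4 | h4 <;> linarith
  -- As the loop has not stopped, some side is still long, which limits `n` through `hH`.
  · have h2 : (1 + 1 / L) ^ (n + 1) ≤ 2 :=
      hH n (hj.trans_le (mul_le_mul_of_nonneg_left (hn2 j) (Real.sqrt_nonneg _)))
    change (1 + 1 / L) * s.err ≤ 2 * η
    nlinarith
  · change (s.R.interBall x.1 (r / 3)).side i ≤ _
    have h1 := s.R.side_interBall_le (x := x.1) (ρ := r / 3) i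
    have h2 := hn2 F.1
    rw [pow_succ]
    linarith
  · change (s.R.interBall x.1 (r / 3)).FaceTrap f ((1 + 1 / L) * s.err) x.1 F'
    rcases s.R.faceCoord_interBall (x := x.1) hρ.le F' with h1 | h1
    · exact ((hx' F').restrict (fun y hy => mem_of_mem_interBall hy) h1).mono herr'
    · intro _ y hy hyF
      have h2 := hspec F' y hy hyF
      rw [h1, ← hxf]
      rw [hδ2] at h2
      push Not at hfail
      -- Raising the slope buys `err * r / (3 * L)` at distance `r / 3`, more than the net error
      -- `δ²/8 = err * r / (8 * L)`.
      have h3 : (1 + 1 / L) * s.err * (r / 3) = s.err * r / 3 + s.err * r / L / 3 := by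
        field_simp
      have h4 : 0 < s.err * r / L := by positivity
      linarith
  · intro F' hF hF'
    exact absurd hF hF'
  · refine vol_le_mul_vol (fun i => (hB.side_pos i).le) (fun i => side_interBall_le_side i)
      (k := F.1) ?_
    have h1 := s.R.side_interBall_le (x := x.1) (ρ := r / 3) F.1
    change (s.R.interBall x.1 (r / 3)).side F.1 ≤ _
    linarith

/-- A pivot on a trapped interior face would satisfy `f x < f x`. Hence the radius and the mesh of
edge fixing are positive. -/
theorem Invariant.distFace_pos (h : Invariant f η L s) {F : Fin d × Bool} (hF : F ∉ s.fixed) :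
    0 < s.R.distFace s.pivot F := by
  refine lt_of_le_of_ne (abs_nonneg _) fun h0 => ?_
  have := h.trap F (fun h' => hF (h.outer h')) s.pivot h.mem (sub_eq_zero.1 (abs_eq_zero.1 h0.symm))
  rw [← h0] at this
  linarith

theorem Invariant.edgeFixing (h : Invariant f η L s) (hf : IsSmooth f) (hd : 2 ≤ d) (hη : 0 < η)
    (hL : 0 < L) (hH : ∀ n : ℕ, 2 * η < √d * (2 / 3) ^ n → (1 + 1 / L) ^ (n + 1) ≤ 2)
    (hs : ¬ s.R.diam ≤ 2 * η) (hne : s.fixedᶜ.Nonempty) :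
    Invariant f η L ((edgeFixing L s hne).result f) ∧
      Advances s ((GFT.edgeFixing L s hne).result f) := by
  classical
  obtain ⟨F, hF, r, δ, x₁, x₂, x₃, hrF, hδ, hx₁, hx₂, hx₃, hres⟩ := edgeFixing_result f L s hne
  rw [hres]
  clear hres
  have herr : 0 < s.err := hη.trans_le h.le_err
  have hr : 0 < r := hrF ▸ h.distFace_pos hF
  have hρ : 0 < r / 3 := by linarith
  have hδ0 : 0 < δ := by rw [hδ]; positivity
  obtain ⟨m₁, a₁, v₁, -⟩ := probe_spec hf hd h.proper hρ hδ0 (x := (s.pivot, s.value)) h.mem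
  rw [← hx₁] at m₁ a₁ v₁
  obtain ⟨m₂, a₂, v₂, -⟩ := probe_spec hf hd h.proper hρ hδ0 m₁
  rw [← hx₂] at m₂ a₂ v₂
  obtain ⟨m₃, a₃, v₃, -⟩ := probe_spec hf hd h.proper hρ hδ0 m₂
  rw [← hx₃] at m₃ a₃ v₃
  have hv := h.value
  -- The cases come in the order: all three descents succeed, the third fails, the second fails, the
  -- first fails.
  split_ifs with c₁ c₂ c₃
  · have c₁' : f x₁.1 ≤ f s.pivot - s.err * (r / 3) := by rw [← v₁, ← hv]; linarith
    have t₁ : ∀ F, s.R.FaceTrap f s.err x₁.1 F := fun F' => (h.trap F').move herr.le (a₁ _) c₁'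
    have c₂' : f x₂.1 ≤ f x₁.1 - s.err * (r / 3) := by rw [← v₁, ← v₂]; linarith
    have t₂ : ∀ F, s.R.FaceTrap f s.err x₂.1 F := fun F' => (t₁ F').move herr.le (a₂ _) c₂'
    have c₃' : f x₃.1 ≤ f x₂.1 - s.err * (r / 3) := by rw [← v₃, ← v₂]; linarith
    have t₃ : ∀ F, s.R.FaceTrap f s.err x₃.1 F := fun F' => (t₂ F').move herr.le (a₃ _) c₃'
    have hpos := mul_pos herr hρ
    refine ⟨⟨h.proper, h.aspect, m₃, v₃, h.le_err, h.err_le, h.growth, t₃, fun F' hF' => ?_,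
      h.outer.trans (Finset.subset_insert _ _)⟩, .inl ⟨rfl, Finset.card_insert_of_notMem hF⟩⟩
    change s.R.FaceTrap f 0 x₃.1 F'
    rcases Finset.mem_insert.1 hF' with rfl | hF'
    -- Three descents by `err * r / 3` add up to `err` times the initial distance `r` of the face.
    · exact (h.trap F').fix (by rw [← hrF]; linarith)
    · exact (h.fixed F' hF').move le_rfl le_rfl (by linarith)
  · have c₁' : f x₁.1 ≤ f s.pivot - s.err * (r / 3) := by rw [← v₁, ← hv]; linarith
    have t₁ : ∀ F, s.R.FaceTrap f s.err x₁.1 F := fun F' => (h.trap F').move herr.le (a₁ _) c₁'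
    have c₂' : f x₂.1 ≤ f x₁.1 - s.err * (r / 3) := by rw [← v₁, ← v₂]; linarith
    have t₂ : ∀ F, s.R.FaceTrap f s.err x₂.1 F := fun F' => (t₁ F').move herr.le (a₂ _) c₂'
    exact h.shrink hf hd hη hL hH hs hr hrF hδ m₂ v₂ t₂ (hx₃ ▸ c₃)
  · have c₁' : f x₁.1 ≤ f s.pivot - s.err * (r / 3) := by rw [← v₁, ← hv]; linarith
    have t₁ : ∀ F, s.R.FaceTrap f s.err x₁.1 F := fun F' => (h.trap F').move herr.le (a₁ _) c₁'
    exact h.shrink hf hd hη hL hH hs hr hrF hδ m₁ v₁ t₁ (hx₂ ▸ c₂)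
  · exact h.shrink hf hd hη hL hH hs hr hrF hδ h.mem hv h.trap (hx₁ ▸ c₁)

theorem Invariant.step [NeZero d] (h : Invariant f η L s) (hf : IsSmooth f) (hd : 2 ≤ d)
    (hη : 0 < η) (hL : 0 < L)
    (hH : ∀ n : ℕ, 2 * η < √d * (2 / 3) ^ n → (1 + 1 / L) ^ (n + 1) ≤ 2)
    (hs : ¬ s.R.diam ≤ 2 * η) :
    Invariant f η L ((gftStep η L s).result f) ∧ Advances s ((gftStep η L s).result f) := by
  classical
  rw [gftStep]
  split
  · next hne => exact h.edgeFixing hf hd hη hL hH hs hne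
  · next hne =>
    refine h.parallelTrap hf hd hη fun F => ?_
    by_contra hF
    exact hne ⟨F, Finset.mem_compl.2 hF⟩

theorem invariant_init (f : EuclideanSpace ℝ (Fin d) → ℝ) (hη : 0 ≤ η) :
    Invariant f η L ((gftInit d η).result f) := by
  have hout : ∀ F : Fin d × Bool,
      F ∈ (⟨fun _ => 0, fun _ => 1⟩ : Hyperrectangle d).outerFaces := fun F => mem_outerFaces.2 rfl
  refine ⟨⟨fun _ => le_rfl, fun _ => le_rfl, fun _ => zero_lt_one⟩, fun i j => ?_, fun i => ?_, rfl,
    le_rfl, ?_, ⟨0, ?_, fun i => ?_⟩, fun F hF => absurd (hout F) hF,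
    fun F _ hF => absurd (hout F) hF, le_rfl⟩
  all_goals simp only [gftInit, QueryProg.result, newDomain, side]; norm_num
  linarith

/-! ### Stationarity of the output -/

/-- A domain all of whose faces satisfy `P_c` contains a `c`-stationary point. -/
theorem exists_stationary {R : Hyperrectangle d} (hf : IsSmooth f) (hR : R.Proper) {c : ℝ}
    (hc : 0 ≤ c) {x : EuclideanSpace ℝ (Fin d)} (hx : x ∈ R) (h : ∀ F, R.FaceTrap f c x F) :
    ∃ z ∈ R, ∀ᶠ y in 𝓝[cube d] z, f z ≤ f y + c * ‖z - y‖ := by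
  let S : Set (EuclideanSpace ℝ (Fin d)) := {y | y ∈ R}
  have hSc : S ⊆ cube d := fun y hy => hR.mem_cube hy
  have hScompact : IsCompact S := by
    have h1 : IsCompact (Set.Icc R.lower R.upper) := isCompact_Icc
    have h2 := h1.image (PiLp.continuous_toLp 2 fun _ : Fin d => ℝ)
    convert h2 using 1
    ext y
    constructor
    · intro hy
      exact ⟨y.ofLp, ⟨fun i => (hy i).1, fun i => (hy i).2⟩, rfl⟩
    · rintro ⟨q, hq, rfl⟩ i
      exact ⟨hq.1 i, hq.2 i⟩
  have hcont : ContinuousOn (fun y => f y + c * ‖y - x‖) S :=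
    (hf.continuousOn.mono hSc).add (by fun_prop)
  obtain ⟨z, hz, hmin⟩ := hScompact.exists_isMinOn ⟨x, hx⟩ hcont
  have hmin' : ∀ y ∈ R, f z + c * ‖z - x‖ ≤ f y + c * ‖y - x‖ := fun y hy => hmin hy
  refine ⟨z, hz, ?_⟩
  -- On such a face the penalised function exceeds its value `f x` at the pivot, so its minimiser is
  -- elsewhere.
  have hinner : ∀ F : Fin d × Bool, F ∉ R.outerFaces → z F.1 ≠ R.faceCoord F := by
    intro F hF hzF
    have h1 := h F hF z hz hzF
    have h2 := hmin' x hx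
    have h3 : R.distFace x F ≤ ‖z - x‖ := by
      rw [distFace, ← hzF, abs_sub_comm]
      exact PiLp.norm_apply_le (z - x) F.1
    have h4 := mul_le_mul_of_nonneg_left h3 hc
    rw [sub_self, norm_zero] at h2
    linarith
  -- The only faces of `R` that can contain `z` are in the boundary of the cube, so points of the
  -- cube near `z` remain in `R`.
  have hnear : ∀ᶠ y in 𝓝[cube d] z, y ∈ R := by
    have hcoord : ∀ i, Filter.Tendsto (fun y : EuclideanSpace ℝ (Fin d) => y i) (𝓝[cube d] z)
        (𝓝 (z i)) := fun i =>
      ((PiLp.continuous_apply 2 (fun _ : Fin d => ℝ) i).tendsto z).mono_left nhdsWithin_le_nhds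
    have hlow : ∀ i, ∀ᶠ y in 𝓝[cube d] z, R.lower i ≤ y i := by
      intro i
      by_cases hF : (i, false) ∈ R.outerFaces
      · have : R.lower i = 0 := by simpa [faceCoord] using mem_outerFaces.1 hF
        filter_upwards [self_mem_nhdsWithin] with y hy
        rw [this]
        exact (hy i).1
      · have hne : z i ≠ R.lower i := hinner (i, false) hF
        exact ((hcoord i).eventually_const_lt (lt_of_le_of_ne (hz i).1 hne.symm)).mono
          fun y hy => hy.le
    have hupp : ∀ i, ∀ᶠ y in 𝓝[cube d] z, y i ≤ R.upper i := by
      intro i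
      by_cases hF : (i, true) ∈ R.outerFaces
      · have : R.upper i = 1 := by simpa [faceCoord] using mem_outerFaces.1 hF
        filter_upwards [self_mem_nhdsWithin] with y hy
        rw [this]
        exact (hy i).2
      · have hne : z i ≠ R.upper i := hinner (i, true) hF
        exact ((hcoord i).eventually_lt_const (lt_of_le_of_ne (hz i).2 hne)).mono
          fun y hy => hy.le
    filter_upwards [Filter.eventually_all.2 hlow, Filter.eventually_all.2 hupp] with y h1 h2 i
    exact ⟨h1 i, h2 i⟩
  filter_upwards [hnear] with y hy
  have h1 := hmin' y hy
  have h2 : ‖y - x‖ ≤ ‖z - y‖ + ‖z - x‖ := by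
    rw [← norm_sub_rev y z]
    exact norm_sub_le_norm_sub_add_norm_sub y z x
  have h3 := mul_le_mul_of_nonneg_left h2 hc
  linarith

/-- First-order condition at a stationary point. -/
theorem inner_gradient_ge {g z v : EuclideanSpace ℝ (Fin d)} {c : ℝ}
    (hg : HasGradientWithinAt f g (cube d) z)
    (hz : ∀ᶠ y in 𝓝[cube d] z, f z ≤ f y + c * ‖z - y‖) (hzc : z ∈ cube d)
    (h0 : ∀ i, z i = 0 → 0 ≤ v i) (h1 : ∀ i, z i = 1 → v i ≤ 0) :
    -(c * ‖v‖) ≤ inner ℝ g v := by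
  have hline : Filter.Tendsto (fun t : ℝ => z + t • v) (𝓝[>] 0) (𝓝 z) := by
    have : Filter.Tendsto (fun t : ℝ => z + t • v) (𝓝 0) (𝓝 (z + (0 : ℝ) • v)) :=
      Continuous.tendsto (by fun_prop) 0
    rw [zero_smul, add_zero] at this
    exact this.mono_left nhdsWithin_le_nhds
  have hcoord : ∀ i, Filter.Tendsto (fun t : ℝ => (z + t • v) i) (𝓝[>] 0) (𝓝 (z i)) := fun i =>
    ((PiLp.continuous_apply 2 (fun _ : Fin d => ℝ) i).tendsto z).comp hline
  have hlow : ∀ i, ∀ᶠ t in 𝓝[>] (0 : ℝ), 0 ≤ (z + t • v) i := by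
    intro i
    rcases (hzc i).1.eq_or_lt with h | h
    · filter_upwards [self_mem_nhdsWithin] with t ht
      have := mul_nonneg (le_of_lt ht) (h0 i h.symm)
      simpa [← h] using this
    · exact ((hcoord i).eventually_const_lt h).mono fun t ht => ht.le
  have hupp : ∀ i, ∀ᶠ t in 𝓝[>] (0 : ℝ), (z + t • v) i ≤ 1 := by
    intro i
    rcases (hzc i).2.eq_or_lt with h | h
    · filter_upwards [self_mem_nhdsWithin] with t ht
      have := mul_nonpos_of_nonneg_of_nonpos (le_of_lt ht) (h1 i h)
      simpa [h] using this
    · exact ((hcoord i).eventually_lt_const h).mono fun t ht => ht.le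
  have hcube : ∀ᶠ t in 𝓝[>] (0 : ℝ), z + t • v ∈ cube d := by
    filter_upwards [Filter.eventually_all.2 hlow, Filter.eventually_all.2 hupp] with t a b i
    exact ⟨a i, b i⟩
  -- The sign conditions on `v` keep `z + t • v` in the cube for small `t > 0`, so the one-sided
  -- difference quotient converges to the directional derivative.
  have hlim := hg.hasFDerivWithinAt.lim (c := fun t : ℝ => t⁻¹) (d := fun t : ℝ => t • v)
    (v := v) (l := 𝓝[>] (0 : ℝ)) ?_ hcube ?_
  · have hev : ∀ᶠ t in 𝓝[>] (0 : ℝ), -(c * ‖v‖) ≤ t⁻¹ • (f (z + t • v) - f z) := by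
      have htend : Filter.Tendsto (fun t : ℝ => z + t • v) (𝓝[>] 0) (𝓝[cube d] z) :=
        tendsto_nhdsWithin_iff.2 ⟨hline, hcube⟩
      filter_upwards [htend.eventually hz, self_mem_nhdsWithin] with t ht ht0
      have ht0' : (0 : ℝ) < t := ht0
      rw [sub_add_cancel_left, norm_neg, norm_smul, Real.norm_of_nonneg ht0'.le] at ht
      rw [smul_eq_mul, le_inv_mul_iff₀ ht0']
      linarith
    have := ge_of_tendsto hlim hev
    simpa using this
  · simpa using hline.sub_const z
  · refine tendsto_const_nhds.congr' ?_
    filter_upwards [self_mem_nhdsWithin] with t ht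
    rw [smul_smul, inv_mul_cancel₀ (ne_of_gt ht), one_smul]

theorem norm_sub_le_diam {R : Hyperrectangle d} {x y : EuclideanSpace ℝ (Fin d)} (hx : x ∈ R)
    (hy : y ∈ R) : ‖x - y‖ ≤ R.diam := by
  rw [EuclideanSpace.norm_eq, diam]
  refine Real.sqrt_le_sqrt (Finset.sum_le_sum fun i _ => ?_)
  obtain ⟨h1, h2⟩ := hx i
  obtain ⟨h3, h4⟩ := hy i
  rw [PiLp.sub_apply, Real.norm_eq_abs]
  refine pow_le_pow_left₀ (abs_nonneg _) ?_ 2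
  rw [side, abs_le]
  constructor <;> linarith

theorem side_le_diam {R : Hyperrectangle d} (i : Fin d) : R.side i ≤ R.diam := by
  refine Real.le_sqrt_of_sq_le ?_
  exact Finset.single_le_sum (f := fun i => R.side i ^ 2) (fun i _ => sq_nonneg _)
    (Finset.mem_univ i)

/-- Rounding is needed for constraints: a cube face containing the stationary point `z` contains a
face of `R`, hence also the rounded pivot. So every direction into the cube from the rounded pivot
is admissible at `z`. The slopes `err ≤ 2 * η` at `z` and `2 * η` for the change of gradient add up.
As `2 * η < 1`, `R` cannot touch two opposite cube faces. -/
theorem Invariant.isStationary (h : Invariant f η L s) (hf : IsSmooth f) (hη : 0 < η)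
    (hη1 : 2 * η < 1) (hs : s.R.diam ≤ 2 * η) : IsStationary f (4 * η) (roundedPivot s) := by
  classical
  have hthin : ∀ i, s.R.lower i = 0 → s.R.upper i ≠ 1 := by
    intro i h0 h1
    have := (side_le_diam (R := s.R) i).trans hs
    rw [side, h0, h1] at this
    linarith
  have hxR : roundedPivot s ∈ s.R := by
    intro i
    have := h.mem i
    have := (h.proper.lt i).le
    simp only [roundedPivot]
    split_ifs with h0 h1
    · exact ⟨h0.le, h0 ▸ this⟩
    · exact ⟨h1 ▸ this, h1.ge⟩
    · assumption
  have hx0 : ∀ i, s.R.lower i = 0 → roundedPivot s i = 0 := fun i hi => by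
    simp [roundedPivot, hi]
  have hx1 : ∀ i, s.R.upper i = 1 → roundedPivot s i = 1 := fun i hi => by
    have : s.R.lower i ≠ 0 := fun h0 => hthin i h0 hi
    simp [roundedPivot, hi, this]
  have hxc := h.proper.mem_cube hxR
  have herr : 0 ≤ s.err := hη.le.trans h.le_err
  obtain ⟨z, hz, hstat⟩ := exists_stationary hf h.proper herr h.mem h.trap
  have hzc := h.proper.mem_cube hz
  refine ⟨hxc, fun ε' hε' => ?_⟩
  obtain ⟨g, hg, hLip⟩ := hf
  have hlin := (hg _ hxc).hasFDerivWithinAt.isLittleO.bound (sub_pos.2 hε')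
  filter_upwards [hlin, self_mem_nhdsWithin] with y hy hyc
  have h1 := inner_gradient_ge (v := y - roundedPivot s) (hg z hzc) hstat hzc
    (fun i hi => by
      have h0 : s.R.lower i = 0 := le_antisymm (hi ▸ (hz i).1) (h.proper.nonneg i)
      simpa [hx0 i h0] using (hyc i).1)
    (fun i hi => by
      have h0 : s.R.upper i = 1 := le_antisymm (h.proper.le_one i) (hi ▸ (hz i).2)
      simpa [hx1 i h0] using (hyc i).2)
  have h2 : inner ℝ (g z - g (roundedPivot s)) (y - roundedPivot s) ≤
      2 * η * ‖y - roundedPivot s‖ := by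
    refine (real_inner_le_norm _ _).trans ?_
    gcongr
    exact ((hLip z hzc _ hxc).trans (norm_sub_le_diam hz hxR)).trans hs
  rw [inner_sub_left] at h2
  have h3 := mul_le_mul_of_nonneg_right h.err_le (norm_nonneg (y - roundedPivot s))
  have h4 := (abs_le.1 ((Real.norm_eq_abs _).symm.trans_le hy)).1
  rw [norm_sub_rev (roundedPivot s) y]
  have h5 : (InnerProductSpace.toDual ℝ (EuclideanSpace ℝ (Fin d)) (g (roundedPivot s)))
      (y - roundedPivot s) = inner ℝ (g (roundedPivot s)) (y - roundedPivot s) := rfl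
  rw [h5] at h4
  linarith

/-! ### The cost of one step -/

/-- A common bound for both kinds of step: a side `l ≤ r` with mesh of order `√r` needs of order
`√r` cells, and `r` is at most the longest side `σ`. -/
theorem grid_ratio_le {r δ σ l : ℝ} (hη : 0 < η) (hL : 0 < L) (hr : 0 < r) (hrσ : r ≤ σ)
    (hl0 : 0 ≤ l) (hl : l ≤ r) (hδ : √(r * η / L) ≤ δ) :
    √((d : ℝ) - 1) * l / δ ≤ √(d * L / η * σ) := by
  have hσ : 0 < σ := hr.trans_le hrσ
  have hδ0 : 0 < √(r * η / L) := by positivity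
  rw [div_le_iff₀ (hδ0.trans_le hδ)]
  calc √((d : ℝ) - 1) * l ≤ √d * r := by
        gcongr
        linarith
    _ = √(d * L / η * r) * √(r * η / L) := by
        rw [← Real.sqrt_mul (by positivity), show d * L / η * r * (r * η / L) = d * r ^ 2 by
          field_simp, Real.sqrt_mul (by positivity), Real.sqrt_sq hr.le]
    _ ≤ √(d * L / η * σ) * δ := by gcongr

theorem edgeFixing_cost (f : EuclideanSpace ℝ (Fin d) → ℝ) (L : ℝ) (s : State d)
    (h : s.fixedᶜ.Nonempty) : ∃ F ∉ s.fixed, ∃ r δ x₁ x₂, r = s.R.distFace s.pivot F ∧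
      δ = √(s.err * r / L) ∧ x₁ = probe f s.R (r / 3) δ (s.pivot, s.value) ∧
      x₂ = probe f s.R (r / 3) δ x₁ ∧
      (edgeFixing L s h).depth f = 3 ∧
      (edgeFixing L s h).work f = ((s.R.interBall s.pivot (r / 3)).boundaryNet δ).card +
        (((s.R.interBall x₁.1 (r / 3)).boundaryNet δ).card +
        (((s.R.interBall x₂.1 (r / 3)).boundaryNet δ).card + 0)) ∧
      ∀ K, (edgeFixing L s h).QueriesIn K f =
        ((∀ p ∈ (s.R.interBall s.pivot (r / 3)).boundaryNet δ, p ∈ K) ∧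
        (∀ p ∈ (s.R.interBall x₁.1 (r / 3)).boundaryNet δ, p ∈ K) ∧
        (∀ p ∈ (s.R.interBall x₂.1 (r / 3)).boundaryNet δ, p ∈ K) ∧ True) :=
  ⟨_, Finset.mem_compl.1 (Finset.exists_min_image s.fixedᶜ (s.R.distFace s.pivot) h).choose_spec.1,
    _, _, _, _, rfl, rfl, rfl, rfl, rfl, rfl, fun _ => rfl⟩

theorem Invariant.edgeFixing_cost [NeZero d] (h : Invariant f η L s) (hf : IsSmooth f)
    (hd : 2 ≤ d) (hη : 0 < η) (hL : 1 ≤ L) (hne : s.fixedᶜ.Nonempty) :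
    (GFT.edgeFixing L s hne).depth f ≤ 3 ∧ (GFT.edgeFixing L s hne).QueriesIn (cube d) f ∧
      ((GFT.edgeFixing L s hne).work f : ℝ) ≤
        6 * d * (√(d * L / η * s.R.side s.R.longest) + 2) ^ (d - 1) := by
  obtain ⟨F, hF, r, δ, x₁, x₂, hrF, hδ, hx₁, hx₂, hdepth, hwork, hq⟩ :=
    GFT.edgeFixing_cost f L s hne
  have herr : 0 < s.err := hη.trans_le h.le_err
  have hr : 0 < r := hrF ▸ h.distFace_pos hF
  have hρ : 0 < r / 3 := by linarith
  have hδ0 : 0 < δ := by rw [hδ]; positivity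
  have m₁ := (probe_spec hf hd h.proper hρ hδ0 (x := (s.pivot, s.value)) h.mem).1
  rw [← hx₁] at m₁
  have m₂ := (probe_spec hf hd h.proper hρ hδ0 m₁).1
  rw [← hx₂] at m₂
  have hin : ∀ x ∈ s.R, ∀ p ∈ (s.R.interBall x (r / 3)).boundaryNet δ, p ∈ cube d :=
    fun x hx p hp => (h.proper.interBall hx hρ).mem_cube
      (mem_of_mem_boundaryNet (h.proper.interBall hx hρ) hp)
  have hcard : ∀ x ∈ s.R,
      (((s.R.interBall x (r / 3)).boundaryNet δ).card : ℝ) ≤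
        2 * d * (√(d * L / η * s.R.side s.R.longest) + 2) ^ (d - 1) := by
    intro x hx
    refine card_boundaryNet_le (Real.sqrt_nonneg _) fun j =>
      grid_ratio_le hη (by linarith) hr ?_ ((h.proper.interBall hx hρ).side_pos j).le ?_ ?_
    · rw [hrF]
      exact (distFace_le_side h.mem F).trans (s.R.side_le_longest _)
    · have := s.R.side_interBall_le (x := x) (ρ := r / 3) j
      linarith
    · rw [hδ, mul_comm]
      have := h.le_err
      gcongr
  refine ⟨hdepth.le, ?_, ?_⟩
  · rw [hq]
    exact ⟨hin _ h.mem, hin _ m₁, hin _ m₂, trivial⟩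
  · rw [hwork]
    push_cast
    linarith [hcard _ h.mem, hcard _ m₁, hcard _ m₂]

open scoped Classical in
theorem parallelTrap_cost [NeZero d] (f : EuclideanSpace ℝ (Fin d) → ℝ) (η : ℝ) (s : State d) :
    ∃ u w : ℝ, (u = s.R.lower s.R.longest + s.R.otherSide s.R.longest / 6 ∨
        u = s.R.upper s.R.longest - s.R.otherSide s.R.longest / 6) ∧
      (w = s.R.lower s.R.longest + s.R.otherSide s.R.longest / 3 ∨
        w = s.R.upper s.R.longest - s.R.otherSide s.R.longest / 3) ∧
      (parallelTrap η s).depth f = 1 ∧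
      (parallelTrap η s).work f =
        (s.R.sliceNet s.R.longest u √(s.R.otherSide s.R.longest * η) ∪
          s.R.sliceNet s.R.longest w √(s.R.otherSide s.R.longest * η)).card + 0 ∧
      ∀ K, (parallelTrap η s).QueriesIn K f =
        ((∀ p ∈ s.R.sliceNet s.R.longest u √(s.R.otherSide s.R.longest * η) ∪
          s.R.sliceNet s.R.longest w √(s.R.otherSide s.R.longest * η), p ∈ K) ∧ True) :=
  ⟨_, _, ite_eq_or_eq _ _ _, ite_eq_or_eq _ _ _, rfl, rfl, fun _ => rfl⟩

theorem Invariant.parallelTrap_cost [NeZero d] (h : Invariant f η L s)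
    (hd : 2 ≤ d) (hη : 0 < η) (hL : 1 ≤ L) :
    (GFT.parallelTrap η s).depth f ≤ 3 ∧ (GFT.parallelTrap η s).QueriesIn (cube d) f ∧
      ((GFT.parallelTrap η s).work f : ℝ) ≤
        6 * d * (√(d * L / η * s.R.side s.R.longest) + 2) ^ (d - 1) := by
  classical
  obtain ⟨u, w, hu, hw, hdepth, hwork, hq⟩ := GFT.parallelTrap_cost f η s
  have hmax := s.R.side_le_longest
  set k := s.R.longest
  obtain ⟨j, hjk, hjr⟩ := s.R.exists_side_eq_otherSide hd k
  have hother : ∀ i ≠ k, s.R.side i ≤ s.R.otherSide k := fun i hi => side_le_otherSide hi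
  set r := s.R.otherSide k
  have hr0 : 0 < r := hjr ▸ h.proper.side_pos j
  have hrl : r ≤ s.R.side k := hjr ▸ hmax j
  have hside : s.R.side k = s.R.upper k - s.R.lower k := rfl
  have hu1 : s.R.lower k ≤ u ∧ u ≤ s.R.upper k := by
    rcases hu with rfl | rfl <;> constructor <;> linarith
  have hw1 : s.R.lower k ≤ w ∧ w ≤ s.R.upper k := by
    rcases hw with rfl | rfl <;> constructor <;> linarith
  have hcard : ∀ c, ((s.R.sliceNet k c √(r * η)).card : ℝ) ≤
      (√(d * L / η * s.R.side k) + 2) ^ (d - 1) := fun c => by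
    refine card_sliceNet_le (Real.sqrt_nonneg _) fun j hj =>
      grid_ratio_le hη (by linarith) hr0 hrl (h.proper.side_pos j).le (hother j hj) ?_
    exact Real.sqrt_le_sqrt (div_le_self (by positivity) hL)
  refine ⟨by omega, ?_, ?_⟩
  · rw [hq]
    refine ⟨fun p hp => ?_, trivial⟩
    rcases Finset.mem_union.1 hp with hp | hp
    · exact h.proper.mem_cube (mem_of_mem_sliceNet h.proper hu1.1 hu1.2 hp).1
    · exact h.proper.mem_cube (mem_of_mem_sliceNet h.proper hw1.1 hw1.2 hp).1
  · have h1 : ((GFT.parallelTrap η s).work f : ℝ) ≤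
        (s.R.sliceNet k u √(r * η)).card + (s.R.sliceNet k w √(r * η)).card := by
      rw [hwork, add_zero]
      exact_mod_cast Finset.card_union_le _ _
    have hd' : (2 : ℝ) ≤ d := by exact_mod_cast hd
    have h2 : 0 ≤ (√(d * L / η * s.R.side k) + 2) ^ (d - 1) := by positivity
    nlinarith [hcard u, hcard w]

/-- The depth, the location and the number of the queries of one step. -/
theorem Invariant.step_cost [NeZero d] (h : Invariant f η L s) (hf : IsSmooth f)
    (hd : 2 ≤ d) (hη : 0 < η) (hL : 1 ≤ L) :
    (gftStep η L s).depth f ≤ 3 ∧ (gftStep η L s).QueriesIn (cube d) f ∧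
      ((gftStep η L s).work f : ℝ) ≤
        6 * d * (√(d * L / η * s.R.side s.R.longest) + 2) ^ (d - 1) := by
  classical
  rw [gftStep]
  split
  · exact h.edgeFixing_cost hf hd hη hL _
  · exact h.parallelTrap_cost hd hη hL

theorem Invariant.pow_side_le_vol (h : Invariant f η L s) (i : Fin d) :
    (s.R.side i / 3) ^ d ≤ s.R.vol := by
  have := Finset.prod_le_prod (s := Finset.univ) (f := fun _ : Fin d => s.R.side i / 3)
    (g := s.R.side) (fun j _ => by have := h.proper.side_pos i; positivity)
    fun j _ => by have := h.aspect i j; linarith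
  rwa [Finset.prod_const, Finset.card_univ, Fintype.card_fin] at this

/-- The work of one step, bounded in terms of the volume of the domain. -/
theorem Invariant.step_work_le [NeZero d] (h : Invariant f η L s) (hf : IsSmooth f)
    (hd : 2 ≤ d) (hη : 0 < η) (hL : 1 ≤ L) :
    ((gftStep η L s).work f : ℝ) ≤
      6 * d * 2 ^ (d - 1) * (√(3 * d * L / η) ^ (d - 1) * √√s.R.vol + 2 ^ (d - 1)) := by
  refine (h.step_cost hf hd hη hL).2.2.trans ?_
  set σ := s.R.side s.R.longest
  have hσ : 0 < σ := h.proper.side_pos _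
  have hσ1 : σ ≤ 1 := h.proper.side_le_one _
  have hV := h.proper.vol_pos
  have hL0 : 0 < L := by linarith
  have h1 : √(d * L / η * σ) = √(3 * d * L / η) * √(σ / 3) := by
    rw [← Real.sqrt_mul (by positivity)]
    congr 1
    ring
  -- This is where `d ≥ 2` yields geometric decay in every dimension: `2 * (d - 1) ≥ d`, so the
  -- fourth power is at most `(σ / 3) ^ d`.
  have h2 : √(σ / 3) ^ (d - 1) ≤ √√s.R.vol := by
    refine Real.le_sqrt_of_sq_le (Real.le_sqrt_of_sq_le ?_)
    calc ((√(σ / 3) ^ (d - 1)) ^ 2) ^ 2 = (√(σ / 3) ^ 2) ^ (2 * (d - 1)) := by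
          rw [← pow_mul, ← pow_mul, ← pow_mul]; congr 1; ring
      _ = (σ / 3) ^ (2 * (d - 1)) := by rw [Real.sq_sqrt (by positivity)]
      _ ≤ (σ / 3) ^ d := pow_le_pow_of_le_one (by positivity) (by linarith) (by omega)
      _ ≤ s.R.vol := h.pow_side_le_vol _
  have h3 : (√(d * L / η * σ) + 2) ^ (d - 1) ≤
      2 ^ (d - 1) * (√(d * L / η * σ) ^ (d - 1) + 2 ^ (d - 1)) := by
    refine (add_pow_le (Real.sqrt_nonneg _) zero_le_two _).trans ?_
    gcongr
    · norm_num
    · omega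
  have h4 : √(d * L / η * σ) ^ (d - 1) ≤ √(3 * d * L / η) ^ (d - 1) * √√s.R.vol := by
    rw [h1, mul_pow]
    gcongr
  calc _ ≤ 6 * d * (2 ^ (d - 1) * (√(d * L / η * σ) ^ (d - 1) + 2 ^ (d - 1))) := by gcongr
    _ ≤ 6 * d * (2 ^ (d - 1) * (√(3 * d * L / η) ^ (d - 1) * √√s.R.vol + 2 ^ (d - 1))) := by gcongr
    _ = _ := by ring

/-! ### Counting steps -/

/-- The number of faces that are not fixed. -/
def unfixed (s : State d) : ℝ := 2 * d - s.fixed.card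

theorem unfixed_nonneg (s : State d) : 0 ≤ unfixed s := by
  have h : s.fixed.card ≤ d * 2 := by simpa using Finset.card_le_univ s.fixed
  have : (s.fixed.card : ℝ) ≤ d * 2 := by exact_mod_cast h
  rw [unfixed]
  linarith

theorem unfixed_le (s : State d) : unfixed s ≤ 2 * d :=
  sub_le_self _ (Nat.cast_nonneg _)

/-- A potential that decreases by at least `1` in each step. -/
def stepPotential (s : State d) : ℝ := unfixed s + (2 * d + 1) * (18 * Real.log s.R.vol)

/-- A potential that controls the sum of the fourth roots of the volumes. -/
def volPotential (s : State d) : ℝ := √√s.R.vol * (unfixed s + 72 * (2 * d + 1))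

/-- Since `18 * log (17/18) ≤ -1`, a loss of volume releases `2 * d + 1`: one unit for the step, and
`2 * d` for the faces that may become unfixed. -/
theorem Advances.stepPotential {s s' : State d} (h : Advances s s') (hV : 0 < s.R.vol)
    (hV' : 0 < s'.R.vol) : 1 + stepPotential s' ≤ stepPotential s := by
  rcases h with ⟨hR, hc⟩ | h
  · rw [GFT.stepPotential, GFT.stepPotential, unfixed, unfixed, hR, hc]
    push_cast
    linarith
  · have h1 := Real.log_le_log hV' h
    rw [Real.log_mul (by norm_num) hV.ne'] at h1
    have h2 := Real.log_le_sub_one_of_pos (show (0 : ℝ) < 17 / 18 by norm_num)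
    have h3 : 18 * Real.log s'.R.vol ≤ 18 * Real.log s.R.vol - 1 := by linarith
    have h4 := mul_le_mul_of_nonneg_left h3 (show (0 : ℝ) ≤ 2 * d + 1 by positivity)
    rw [GFT.stepPotential, GFT.stepPotential]
    linarith [unfixed_le s', unfixed_nonneg s]

theorem Advances.volPotential {s s' : State d} (h : Advances s s') (hV : 0 < s.R.vol)
    (hV' : 0 < s'.R.vol) : √√s.R.vol + volPotential s' ≤ volPotential s := by
  rcases h with ⟨hR, hc⟩ | h
  · rw [GFT.volPotential, GFT.volPotential, unfixed, unfixed, hR, hc]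
    push_cast
    linarith
  · have h0 : 0 ≤ √√s.R.vol := Real.sqrt_nonneg _
    have hsq : ∀ {v : ℝ}, 0 ≤ v → √√v ^ 4 = v := fun {v} hv => by
      rw [show 4 = 2 * 2 from rfl, pow_mul, Real.sq_sqrt (Real.sqrt_nonneg _), Real.sq_sqrt hv]
    -- `17/18 ≤ (71/72)^4`; the weight `72` in the potential is the reciprocal of the resulting
    -- relative decrease `1/72`.
    have h1 : √√s'.R.vol ≤ 71 / 72 * √√s.R.vol := by
      refine le_of_pow_le_pow_left₀ (n := 4) (by norm_num) (by positivity) ?_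
      rw [mul_pow, hsq hV.le, hsq hV'.le]
      refine h.trans ?_
      gcongr
      norm_num
    have h2 : unfixed s' + 72 * (2 * d + 1) ≤ 2 * d + 72 * (2 * d + 1) := by
      linarith [unfixed_le s']
    have hd : (0 : ℝ) ≤ d := Nat.cast_nonneg d
    have h3 := mul_le_mul h1 h2 (by linarith [unfixed_nonneg s']) (by positivity)
    rw [GFT.volPotential, GFT.volPotential]
    have h4 := mul_nonneg h0 (unfixed_nonneg s)
    have h5 := mul_nonneg h0 hd
    linarith

/-! ### Runs of the algorithm and the number of passes. -/

section Run

/-- The state of gradient flow trapping after `t` passes through the loop. -/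
def gftState (d : ℕ) [NeZero d] (ε : ℝ) (f : EuclideanSpace ℝ (Fin d) → ℝ) (t : ℕ) : State d :=
  (gradientFlowTrapping d ε).stateAt f t

variable {ε : ℝ}

theorem run [NeZero d] (hf : IsSmooth f) (hd : 2 ≤ d) (hε : 0 < ε) (hL : 0 < 500 * Real.log (d / ε))
    (hH : ∀ n : ℕ, 2 * (ε / 4) < √d * (2 / 3) ^ n →
      (1 + 1 / (500 * Real.log (d / ε))) ^ (n + 1) ≤ 2) (T : ℕ)
    (hT : ∀ t < T, ¬ (gftState d ε f t).R.diam ≤ 2 * (ε / 4)) :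
    Invariant f (ε / 4) (500 * Real.log (d / ε)) (gftState d ε f T) ∧
      T + stepPotential (gftState d ε f T) ≤ 2 * d ∧
      ∑ t ∈ Finset.range T, √√(gftState d ε f t).R.vol +
        volPotential (gftState d ε f T) ≤ 2 * d + 72 * (2 * d + 1) := by
  induction T with
  | zero =>
    have hV : (gftState d ε f 0).R.vol = 1 := by
      change Hyperrectangle.vol (⟨fun _ => 0, fun _ => 1⟩ : Hyperrectangle d) = 1
      simp [vol, side]
    have hu := unfixed_le (gftState d ε f 0)
    refine ⟨invariant_init f (by positivity), ?_, ?_⟩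
    · rw [stepPotential, hV]
      simpa using hu
    · rw [volPotential, hV]
      simpa using hu
  | succ T ih =>
    obtain ⟨h1, h2, h3⟩ := ih fun t ht => hT t (by omega)
    obtain ⟨h4, h5⟩ := h1.step hf hd (by positivity) hL hH (hT T (by omega))
    have h6 := h5.stepPotential h1.proper.vol_pos h4.proper.vol_pos
    have h7 := h5.volPotential h1.proper.vol_pos h4.proper.vol_pos
    refine ⟨h4, ?_, ?_⟩
    · push_cast
      refine le_trans ?_ h2
      rw [add_assoc]
      exact add_le_add_right h6 _
    · rw [Finset.sum_range_succ, add_assoc]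
      refine le_trans ?_ h3
      exact add_le_add_right h7 _

theorem one_le_log_div (hd : 2 ≤ d) (hε : 0 < ε) (hε2 : ε ≤ 1 / 2) : 1 ≤ Real.log (d / ε) := by
  have hd' : (2 : ℝ) ≤ d := by exact_mod_cast hd
  rw [Real.le_log_iff_exp_le (by positivity)]
  have : (4 : ℝ) ≤ d / ε := by
    rw [le_div_iff₀ hε]
    linarith
  linarith [Real.exp_one_lt_d9]

/-- The hypothesis forces `(3/2)^n ≤ 2 * d / ε`, hence `n + 1 ≤ 7 * log (d / ε)`, and the growth is
at most `exp (7/500) ≤ 2`. -/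
theorem error_growth_le (hd : 2 ≤ d) (hε : 0 < ε) (hε2 : ε ≤ 1 / 2) (n : ℕ)
    (hn : 2 * (ε / 4) < √d * (2 / 3) ^ n) :
    (1 + 1 / (500 * Real.log (d / ε))) ^ (n + 1) ≤ 2 := by
  have hl := one_le_log_div hd hε hε2
  set l := Real.log (d / ε)
  have hd' : (2 : ℝ) ≤ d := by exact_mod_cast hd
  have hsd : √(d : ℝ) ≤ d := Real.sqrt_le_left (by positivity) |>.2 (by nlinarith)
  have h1 : (3 / 2 : ℝ) ^ n ≤ 2 * (d / ε) := by
    have h2 : (3 / 2 : ℝ) ^ n * (2 / 3) ^ n = 1 := by rw [← mul_pow]; norm_num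
    have h3 : (0 : ℝ) < (3 / 2) ^ n := by positivity
    have h4 := mul_lt_mul_of_pos_left hn h3
    rw [mul_left_comm ((3 / 2 : ℝ) ^ n) √(d : ℝ), h2, mul_one] at h4
    rw [mul_div_assoc', le_div_iff₀ hε]
    linarith
  have h2 := Real.log_le_log (by positivity) h1
  rw [Real.log_pow, Real.log_mul (by norm_num) (by positivity)] at h2
  have h3 := Real.one_sub_inv_le_log_of_pos (show (0 : ℝ) < 3 / 2 by norm_num)
  have h4 := Real.log_two_lt_d9
  have h5 : (n : ℝ) * (1 / 3) ≤ n * Real.log (3 / 2) := by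
    gcongr
    refine le_trans ?_ h3
    norm_num
  have h6 : (n : ℝ) + 1 ≤ 7 * l := by linarith
  calc (1 + 1 / (500 * l)) ^ (n + 1) ≤ Real.exp (1 / (500 * l)) ^ (n + 1) := by
        gcongr
        linarith [Real.add_one_le_exp (1 / (500 * l))]
    _ = Real.exp ((n + 1) * (1 / (500 * l))) := by
        rw [← Real.exp_nat_mul]
        push_cast
        rfl
    _ ≤ Real.exp (Real.log 2) := by
        refine Real.exp_le_exp.2 ?_
        rw [mul_one_div]
        have : ((n : ℝ) + 1) / (500 * l) ≤ 7 / 500 := by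
          rw [div_le_div_iff₀ (by positivity) (by norm_num)]
          linarith
        linarith [Real.log_two_gt_d9]
    _ = 2 := Real.exp_log (by norm_num)

/-- The number of passes through the loop. -/
theorem passes_le [NeZero d] (hf : IsSmooth f) (hd : 2 ≤ d) (hε : 0 < ε) (hε2 : ε ≤ 1 / 2) (T : ℕ)
    (hT : ∀ t < T, ¬ (gftState d ε f t).R.diam ≤ 2 * (ε / 4)) :
    (T : ℝ) ≤ 140 * d ^ 2 * Real.log (d / ε) := by
  have hl := one_le_log_div hd hε hε2
  have hd' : (2 : ℝ) ≤ d := by exact_mod_cast hd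
  rcases T with _ | T
  · simp only [Nat.cast_zero]
    positivity
  -- The potential is read off just before the last pass: that state has not halted, so a side
  -- exceeds `ε / (2 * √d)` and the aspect ratio bounds the volume below.
  obtain ⟨h1, h2, -⟩ := run hf hd hε (by linarith) (error_growth_le hd hε hε2) T
    fun t ht => hT t (by omega)
  obtain ⟨j, hj⟩ := h1.exists_lt_side (by positivity) hd (hT T (by omega))
  have hu := unfixed_nonneg (gftState d ε f T)
  rw [stepPotential] at h2
  have hpos := h1.proper.side_pos j
  have hvol := Real.log_le_log (by positivity) (h1.pow_side_le_vol j)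
  set V := (gftState d ε f T).R.vol
  set a := (gftState d ε f T).R.side j
  rw [Real.log_pow] at hvol
  have hsd : √(d : ℝ) ≤ d := Real.sqrt_le_left (by positivity) |>.2 (by nlinarith)
  have h3 : (a / 3)⁻¹ ≤ 6 * (d / ε) := by
    rw [inv_div, mul_div_assoc', div_le_div_iff₀ hpos hε]
    have := mul_le_mul_of_nonneg_right hsd hpos.le
    linarith
  have h4 := Real.log_le_log (by positivity) h3
  rw [Real.log_inv, Real.log_mul (by norm_num) (by positivity)] at h4
  have h5 : Real.log 6 ≤ 2 := by
    rw [Real.log_le_iff_le_exp (by norm_num), show (2 : ℝ) = 1 + 1 by norm_num, Real.exp_add]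
    nlinarith [Real.exp_one_gt_d9]
  set l := Real.log (d / ε)
  have h6 : -(3 * l) * d ≤ Real.log V := by nlinarith
  have h7 := mul_le_mul_of_nonneg_left h6 (show (0 : ℝ) ≤ (2 * d + 1) * 18 by positivity)
  have h8 : (T : ℝ) ≤ 2 * d + 54 * (2 * d + 1) * d * l := by linarith
  have h9 : (2 : ℝ) * d ≤ d ^ 2 := by nlinarith
  have h10 : (d : ℝ) ^ 2 * 1 ≤ d ^ 2 * l := by gcongr
  have h11 : 2 * d * l ≤ d ^ 2 * l := by gcongr
  push_cast
  linarith

/-- This trades `log (d / ε)` for `log (1 / ε)`; the factor `3 * d` disappears into `d ^ (C * d)`.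
-/
theorem log_div_le (hd : 2 ≤ d) (hε : 0 < ε) (hε2 : ε ≤ 1 / 2) :
    Real.log (d / ε) ≤ 3 * d * Real.log (1 / ε) := by
  have hd' : (2 : ℝ) ≤ d := by exact_mod_cast hd
  have h1 : 1 / 2 ≤ Real.log (1 / ε) := by
    have : Real.log 2 ≤ Real.log (1 / ε) :=
      Real.log_le_log (by norm_num) (by rw [le_div_iff₀ hε]; linarith)
    linarith [Real.log_two_gt_d9]
  have h2 : Real.log (d / ε) = Real.log d + Real.log (1 / ε) := by
    rw [← Real.log_mul (by positivity) (by positivity), mul_one_div]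
  have h3 := Real.log_le_sub_one_of_pos (show (0 : ℝ) < d by linarith)
  nlinarith

end Run

/-! ### Absorbing the constants in the total work. -/

theorem total_work_le {d : ℕ} (hd : 2 ≤ d) {ε : ℝ} (hε : 0 < ε) (hε2 : ε ≤ 1 / 2) {T W : ℝ}
    (hT0 : 0 ≤ T) (hT : T ≤ 140 * d ^ 2 * Real.log (d / ε))
    (hW : W ≤ 1 + 6 * d * 2 ^ (d - 1) *
      (√(3 * d * (500 * Real.log (d / ε)) / (ε / 4)) ^ (d - 1) * (2 * d + 72 * (2 * d + 1)) +
        2 ^ (d - 1) * T)) :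
    W ≤ (d : ℝ) ^ (13 * d) * (Real.log (1 / ε) / ε) ^ (((d : ℝ) - 1) / 2) := by
  have hd' : (2 : ℝ) ≤ d := by exact_mod_cast hd
  have hd0 : (0 : ℝ) ≤ d := by linarith
  have hd1 : (1 : ℝ) ≤ d := by linarith
  have hlog := log_div_le hd hε hε2
  have hl1 := one_le_log_div hd hε hε2
  have hlam : Real.log 2 ≤ Real.log (1 / ε) :=
    Real.log_le_log (by norm_num) (by rw [le_div_iff₀ hε]; linarith)
  have hlam2 : Real.log (1 / ε) ≤ 1 / ε := Real.log_le_self (by positivity)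
  have hlog2 := Real.log_two_gt_d9
  set l := Real.log (d / ε)
  set lam := Real.log (1 / ε)
  have hlam0 : 0 < lam := by linarith
  set X := lam / ε with hX
  have hX1 : 1 ≤ X := by
    rw [hX, le_div_iff₀ hε]
    linarith
  have hsX : 1 ≤ √X := Real.one_le_sqrt.2 hX1
  have hY : X ^ (((d : ℝ) - 1) / 2) = √X ^ (d - 1) := by
    rw [Real.sqrt_eq_rpow, ← Real.rpow_natCast, ← Real.rpow_mul (by linarith),
      Nat.cast_sub (by omega), Nat.cast_one]
    congr 1
    ring
  rw [hY]
  set Y := √X ^ (d - 1) with hYdef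
  have hsXY : √X ≤ Y := le_self_pow₀ hsX (by omega)
  have hY1 : 1 ≤ Y := hsX.trans hsXY
  -- From `lam ≤ 1 / ε` follows `lam² ≤ X`. So the logarithm in the number of passes is absorbed by
  -- `Y`.
  have hlamY : lam ≤ Y := by
    refine le_trans (Real.le_sqrt_of_sq_le ?_) hsXY
    rw [hX, sq, div_eq_mul_one_div]
    gcongr
  -- As `d ≥ 2`, every numerical constant is at most a power of `d`.
  have hpow : ∀ {c : ℝ} (m : ℕ), c ≤ 2 ^ m → c ≤ (d : ℝ) ^ m := fun m hc =>
    hc.trans (pow_le_pow_left₀ zero_le_two hd' m)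
  have h2n : (2 : ℝ) ^ (d - 1) ≤ (d : ℝ) ^ (d - 1) := pow_le_pow_left₀ zero_le_two hd' _
  have hA : √(3 * d * (500 * l) / (ε / 4)) ≤ (d : ℝ) ^ 9 * √X := by
    rw [← Real.sqrt_sq (show (0 : ℝ) ≤ (d : ℝ) ^ 9 by positivity), ← Real.sqrt_mul (by positivity)]
    refine Real.sqrt_le_sqrt ?_
    have e : 3 * d * (500 * l) / (ε / 4) = 6000 * d * l / ε := by
      field_simp
      ring
    rw [e, hX, mul_div_assoc']
    refine div_le_div_of_nonneg_right ?_ hε.le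
    calc 6000 * d * l ≤ 6000 * d * (3 * d * lam) := by gcongr
      _ = 18000 * (d ^ 2 * lam) := by ring
      _ ≤ d ^ 15 * (d ^ 2 * lam) := by
          gcongr
          exact hpow 15 (by norm_num)
      _ = d ^ 17 * lam := by ring
      _ ≤ d ^ 18 * lam := by
          gcongr
          norm_num
      _ = (d ^ 9) ^ 2 * lam := by ring
  have hAn : √(3 * d * (500 * l) / (ε / 4)) ^ (d - 1) ≤ (d : ℝ) ^ (9 * (d - 1)) * Y := by
    rw [pow_mul, hYdef, ← mul_pow]
    exact pow_le_pow_left₀ (Real.sqrt_nonneg _) hA _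
  have hsum : (2 * d + 72 * (2 * d + 1) : ℝ) ≤ d ^ 9 := by
    calc (2 * d + 72 * (2 * d + 1) : ℝ) ≤ 256 * d := by linarith
      _ ≤ d ^ 8 * d := by
          gcongr
          exact hpow 8 (by norm_num)
      _ = d ^ 9 := by ring
  have hTd : T ≤ (d : ℝ) ^ 12 * Y := by
    calc T ≤ 140 * d ^ 2 * (3 * d * lam) := hT.trans (by gcongr)
      _ = 420 * (d ^ 3 * lam) := by ring
      _ ≤ d ^ 9 * (d ^ 3 * Y) := by
          gcongr
          exact hpow 9 (by norm_num)
      _ = d ^ 12 * Y := by ring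
  calc W ≤ 1 + 6 * d * 2 ^ (d - 1) *
        ((d : ℝ) ^ (9 * (d - 1)) * Y * d ^ 9 + d ^ (d - 1) * (d ^ 12 * Y)) := by
        refine hW.trans ?_
        gcongr
    _ = 1 + 6 * d * 2 ^ (d - 1) * ((d ^ (9 * (d - 1) + 9) + d ^ (d - 1 + 12)) * Y) := by ring
    _ ≤ 1 * Y + d ^ 3 * d * d ^ (d - 1) * ((d ^ (9 * d) + d ^ (9 * d)) * Y) := by
        gcongr
        · simpa using hY1
        · exact hpow 3 (by norm_num)
        · omega
        · omega
    _ = (1 + 2 * d ^ (3 + 1 + (d - 1) + 9 * d)) * Y := by ring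
    _ ≤ (d ^ (3 + 1 + (d - 1) + 9 * d) + d * d ^ (3 + 1 + (d - 1) + 9 * d)) * Y := by
        gcongr
        exact one_le_pow₀ hd1
    _ ≤ (d * d ^ (3 + 1 + (d - 1) + 9 * d) + d * d ^ (3 + 1 + (d - 1) + 9 * d)) * Y := by
        gcongr
        exact le_mul_of_one_le_left (by positivity) hd1
    _ = 2 * d ^ (1 + (3 + 1 + (d - 1) + 9 * d)) * Y := by ring
    _ ≤ d * d ^ (1 + (3 + 1 + (d - 1) + 9 * d)) * Y := by gcongr
    _ = d ^ (2 + (3 + 1 + (d - 1) + 9 * d)) * Y := by ring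
    -- The exponent collected so far is `10 * d + 5`, and `5 ≤ 3 * d`.
    _ ≤ d ^ (13 * d) * Y := by
        gcongr
        omega

end GFT

end

/-! ### The theorem. -/

theorem theorem2 :
    ∃ C : ℝ, 0 < C ∧
      ∀ (d : ℕ) [NeZero d], 2 ≤ d →
      ∀ ε : ℝ, 0 < ε → ε ≤ 1 / 2 →
      ∀ f : EuclideanSpace ℝ (Fin d) → ℝ, GFT.IsSmooth f →
        ∃ T : ℕ,
          (gradientFlowTrapping d ε).StopsAt f T ∧
          (gradientFlowTrapping d ε).QueriesIn f (GFT.cube d) T ∧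
          GFT.IsStationary f ε
            ((gradientFlowTrapping d ε).output ((gradientFlowTrapping d ε).stateAt f T)) ∧
          ((gradientFlowTrapping d ε).depth f T : ℝ) ≤ C * (d : ℝ) ^ 2 * Real.log (d / ε) ∧
          ((gradientFlowTrapping d ε).work f T : ℝ) ≤
            (d : ℝ) ^ (C * (d : ℝ)) *
              (Real.log (1 / ε) / ε) ^ (((d : ℝ) - 1) / 2) := by
  classical
  -- Three rounds for each of at most `140 * d² * log (d / ε)` passes, plus one for the initial
  -- query; the exponent `13 * d` of the work is far below `421 * d`.
  refine ⟨421, by norm_num, fun d _ hd ε hε hε2 f hf => ?_⟩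
  have hd' : (2 : ℝ) ≤ d := by exact_mod_cast hd
  have hl := GFT.one_le_log_div hd hε hε2
  -- The bound on passes holds for every run that has not halted, so an endless run would contradict
  -- it.
  have hex : ∃ t, (GFT.gftState d ε f t).R.diam ≤ 2 * (ε / 4) := by
    by_contra! hc
    obtain ⟨T, hT⟩ := exists_nat_gt (140 * (d : ℝ) ^ 2 * Real.log (d / ε))
    exact absurd (GFT.passes_le hf hd hε hε2 T fun t _ => not_le.2 (hc t)) (not_le.2 hT)
  have hhalt := Nat.find_spec hex
  have hmin : ∀ t < Nat.find hex, ¬ (GFT.gftState d ε f t).R.diam ≤ 2 * (ε / 4) :=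
    fun t ht => Nat.find_min hex ht
  set T := Nat.find hex
  have hrun : ∀ t ≤ T, _ := fun t ht => GFT.run hf hd hε (by linarith)
    (GFT.error_growth_le hd hε hε2) t fun u hu => hmin u (by omega)
  have hT := GFT.passes_le hf hd hε hε2 T hmin
  have hcost : ∀ t < T, _ := fun t ht =>
    (hrun t ht.le).1.step_cost hf hd (by positivity) (by linarith)
  refine ⟨T, ⟨hhalt, hmin⟩, ⟨⟨fun p hp i => ?_, trivial⟩, fun t ht => (hcost t ht).2.1⟩, ?_, ?_, ?_⟩
  · rw [Finset.mem_singleton.1 hp]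
    norm_num
  · have := (hrun T le_rfl).1.isStationary hf (by positivity) (by linarith) hhalt
    rwa [show 4 * (ε / 4) = ε by ring] at this
  · have h1 : (gradientFlowTrapping d ε).depth f T ≤ 1 + T * 3 := by
      refine add_le_add le_rfl ?_
      refine (Finset.sum_le_card_nsmul _ _ 3 fun t ht =>
        (hcost t (Finset.mem_range.1 ht)).1).trans_eq ?_
      simp
    have h2 : ((gradientFlowTrapping d ε).depth f T : ℝ) ≤ 1 + T * 3 := by exact_mod_cast h1
    have h3 : (1 : ℝ) ≤ d ^ 2 * Real.log (d / ε) :=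
      one_le_mul_of_one_le_of_one_le (one_le_pow₀ (by linarith)) hl
    linarith
  · have hwork : ((gradientFlowTrapping d ε).work f T : ℝ) =
        1 + ∑ t ∈ Finset.range T, ((GFT.gftStep (ε / 4) (500 * Real.log (d / ε))
          (GFT.gftState d ε f t)).work f : ℝ) := by
      have : (gradientFlowTrapping d ε).work f T =
        1 + ∑ t ∈ Finset.range T, (GFT.gftStep (ε / 4) (500 * Real.log (d / ε))
          (GFT.gftState d ε f t)).work f := rfl
      rw [this]
      push_cast
      rfl
    have hsum := (hrun T le_rfl).2.2
    have hpot : 0 ≤ GFT.volPotential (GFT.gftState d ε f T) :=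
      mul_nonneg (Real.sqrt_nonneg _) (by linarith [GFT.unfixed_nonneg (GFT.gftState d ε f T)])
    refine (GFT.total_work_le hd hε hε2 T.cast_nonneg hT (W := (gradientFlowTrapping d ε).work f T) ?_).trans ?_
    · rw [hwork]
      gcongr
      refine (Finset.sum_le_sum fun t ht => (hrun t (Finset.mem_range.1 ht).le).1.step_work_le hf hd
        (by positivity) (by linarith)).trans ?_
      rw [← Finset.mul_sum, Finset.sum_add_distrib, ← Finset.mul_sum, Finset.sum_const,
        Finset.card_range, nsmul_eq_mul, mul_comm (T : ℝ)]
      gcongr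
      linarith
    · have hlam : Real.log 2 ≤ Real.log (1 / ε) :=
        Real.log_le_log (by norm_num) (by rw [le_div_iff₀ hε]; linarith)
      have := Real.log_two_gt_d9
      have : 0 ≤ Real.log (1 / ε) / ε := div_nonneg (by linarith) hε.le
      gcongr
      rw [← Real.rpow_natCast]
      refine Real.rpow_le_rpow_of_exponent_le (by linarith) ?_
      push_cast
      linarith
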